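/- Let $(\breve N,\breve g)$ be a semi-Riemannian manifold with Levi-Civita connection $\breve\nabla$, and let $\breve P$ be a locally Golden structure on it, i.e. a smooth $(1,1)$-tensor field with $\breve P^2=\breve P+I$, $\breve g(\breve PX,Y)=\breve g(X,\breve PY)$ and $\breve\nabla\breve P=0$. Let $\acute N$ be an immersed submanifold of $\breve N$ whose radical distribution $Rad\,T\acute N=T\acute N\cap T\acute N^{\perp}$ is a smooth distribution of constant rank $r\ge 1$. Let $S(T\acute N)$ and $S(T\acute N^{\perp})$ be smooth complements of $Rad\,T\acute N$ in $T\acute N$ and in $T\acute N^{\perp}$, and let $ltr(T\acute N)$ be a smooth complement of $Rad\,T\acute N$ in the orthogonal complement of $S(T\acute N)\perp S(T\acute N^\perp)$, so that $$T\breve N|_{\acute N}=S(T\acute N)\perp[Rad\,T\acute N\oplus ltr(T\acute N)]\perp S(T\acute N^{\perp}),\qquad tr(T\acute N)=ltr(T\acute N)\perp S(T\acute N^\perp).$$ (It is not required that $ltr(T\acute N)$ be totally null; that case is included.) Assume that $\acute N$ is a transversal lightlike submanifold, i.e. $\breve P(Rad\,T\acute N)=ltr(T\acute N)$ and $\breve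 P(S(T\acute N))\subseteq S(T\acute N^{\perp})$. For vector fields $W,U$ on $\acute N$ write $\breve\nabla_WU=\nabla_WU+h^l(W,U)+h^s(W,U)$ with $\nabla_WU$ tangent to $\acute N$, $h^l(W,U)\in ltr(T\acute N)$, $h^s(W,U)\in S(T\acute N^\perp)$; for a section $V$ of $tr(T\acute N)$ let $-A_VW$ be the part of $\breve\nabla_WV$ tangent to $\acute N$. Let $K_2\breve Ph^l(W,U)$ be the $Rad\,T\acute N$-component of $\breve Ph^l(W,U)$ and $M_1h^s(W,U)$ the $S(T\acute N)$-component of $\breve Ph^s(W,U)$, in the above decomposition of $T\breve N|_{\acute N}$. Then $Rad\,T\acute N$ defines a totally geodesic foliation on $\acute N$ (that is, it is involutive, and $\nabla_WU\in\Gamma(Rad\,T\acute N)$ for all $W,U\in\Gamma(Rad\,T\acute N)$) if and only if, for all $W\in\Gamma(Rad\,T\acute N)$ and $Z\in\Gamma(S(T\acute N))$, the vector field $A_{\breve PZ}W$ has no component in $Rad\,T\acute N$. Moreover, for each such pair $W,Z$, the vector field $A_{\breve PZ}W$ has no component in $Rad\,T\acute N$ if and only if $K_2\breve Ph^l(W,Z)=0$,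 and if and only if $-A_{\breve PZ}W=M_1h^s(W,Z)$. -/

import Mathlib

open Bundle Set
open scoped Manifold ContDiff Topology

noncomputable section

namespace GoldenLightlike

/-! ### Semi-Riemannian and Golden semi-Riemannian manifolds -/

/-- A smooth semi-Riemannian metric on an `n`-dimensional manifold `N`: a smooth field of
symmetric nondegenerate bilinear forms on the tangent spaces. -/
structure SemiRiemannianMetric (n : ℕ) (N : Type*) [TopologicalSpace N]
    [ChartedSpace (EuclideanSpace ℝ (Fin n)) N] [IsManifold (𝓡 n) ∞ N] where
  val (q : N) : TangentSpace (𝓡 n) q →L[ℝ] TangentSpace (𝓡 n) q →L[ℝ] ℝ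
  symm (q : N) (u v : TangentSpace (𝓡 n) q) : val q u v = val q v u
  nondegenerate (q : N) (u : TangentSpace (𝓡 n) q) (hu : ∀ v, val q u v = 0) : u = 0
  smooth : ContMDiff (𝓡 n)
    ((𝓡 n).prod 𝓘(ℝ, EuclideanSpace ℝ (Fin n) →L[ℝ] EuclideanSpace ℝ (Fin n) →L[ℝ] ℝ)) ∞
    (fun q : N ↦ TotalSpace.mk'
      (EuclideanSpace ℝ (Fin n) →L[ℝ] EuclideanSpace ℝ (Fin n) →L[ℝ] ℝ)
      (E := fun q : N ↦ TangentSpace (𝓡 n) q →L[ℝ] TangentSpace (𝓡 n) q →L[ℝ] ℝ) q (val q))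

section Ambient

variable {n : ℕ} {N : Type*} [TopologicalSpace N]
  [ChartedSpace (EuclideanSpace ℝ (Fin n)) N] [IsManifold (𝓡 n) ∞ N]

/-- Linear connections on `N`. In Mathlib's argument order, `D Y q (X q)` is `(D_X Y)(q)`. -/
abbrev LinearConnection (n : ℕ) (N : Type*) [TopologicalSpace N]
    [ChartedSpace (EuclideanSpace ℝ (Fin n)) N] [IsManifold (𝓡 n) ∞ N] :=
  CovariantDerivative (𝓡 n) (EuclideanSpace ℝ (Fin n)) (TangentSpace (𝓡 n) : N → Type _)

/-- `D` is the Levi-Civita connection of `g`: torsion-free and metric. -/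
structure IsLeviCivita (g : SemiRiemannianMetric n N) (D : LinearConnection n N) : Prop where
  torsion_free (X Y : Π q : N, TangentSpace (𝓡 n) q) (q : N)
    (hX : MDifferentiableAt (𝓡 n) (𝓡 n).tangent (fun p ↦ (⟨p, X p⟩ : TangentBundle (𝓡 n) N)) q)
    (hY : MDifferentiableAt (𝓡 n) (𝓡 n).tangent (fun p ↦ (⟨p, Y p⟩ : TangentBundle (𝓡 n) N)) q) :
    D Y q (X q) - D X q (Y q) = VectorField.mlieBracket (𝓡 n) X Y q
  metric (X Y : Π q : N, TangentSpace (𝓡 n) q) (q : N) (w : TangentSpace (𝓡 n) q)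
    (hX : MDifferentiableAt (𝓡 n) (𝓡 n).tangent (fun p ↦ (⟨p, X p⟩ : TangentBundle (𝓡 n) N)) q)
    (hY : MDifferentiableAt (𝓡 n) (𝓡 n).tangent (fun p ↦ (⟨p, Y p⟩ : TangentBundle (𝓡 n) N)) q) :
    mvfderiv (𝓡 n) (fun p ↦ g.val p (X p) (Y p)) q w =
      g.val q (D X q w) (Y q) + g.val q (X q) (D Y q w)

/-- A Golden structure on `(N, g)`: a smooth `(1,1)`-tensor field `P` with `P² = P + I` with which
`g` is compatible, `g (P X, Y) = g (X, P Y)`. -/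
structure GoldenStructure (g : SemiRiemannianMetric n N) where
  P (q : N) : TangentSpace (𝓡 n) q →L[ℝ] TangentSpace (𝓡 n) q
  smooth : ContMDiff (𝓡 n)
    ((𝓡 n).prod 𝓘(ℝ, EuclideanSpace ℝ (Fin n) →L[ℝ] EuclideanSpace ℝ (Fin n))) ∞
    (fun q : N ↦ TotalSpace.mk' (EuclideanSpace ℝ (Fin n) →L[ℝ] EuclideanSpace ℝ (Fin n))
      (E := fun q : N ↦ TangentSpace (𝓡 n) q →L[ℝ] TangentSpace (𝓡 n) q) q (P q))
  golden (q : N) (u : TangentSpace (𝓡 n) q) : P q (P q u) = P q u + u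
  compatible (q : N) (u v : TangentSpace (𝓡 n) q) : g.val q (P q u) v = g.val q u (P q v)

/-- The Golden structure is *locally Golden* when `P` is parallel: `D_X (P Y) = P (D_X Y)`. -/
def GoldenStructure.IsParallel {g : SemiRiemannianMetric n N} (G : GoldenStructure g)
    (D : LinearConnection n N) : Prop :=
  ∀ (Y : Π q : N, TangentSpace (𝓡 n) q) (q : N) (w : TangentSpace (𝓡 n) q),
    MDifferentiableAt (𝓡 n) (𝓡 n).tangent (fun p ↦ (⟨p, Y p⟩ : TangentBundle (𝓡 n) N)) q →
    D (fun p ↦ G.P p (Y p)) q w = G.P q (D Y q w)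

/-- The orthogonal complement of a subspace of `T_q N`. -/
def SemiRiemannianMetric.orth (g : SemiRiemannianMetric n N) {q : N}
    (A : Submodule ℝ (TangentSpace (𝓡 n) q)) : Submodule ℝ (TangentSpace (𝓡 n) q) where
  carrier := {v | ∀ u ∈ A, g.val q u v = 0}
  add_mem' := fun ha hb u hu ↦ by rw [map_add, ha u hu, hb u hu, add_zero]
  zero_mem' := fun u _ ↦ map_zero _
  smul_mem' := fun c v hv u hu ↦ by rw [map_smul, hv u hu, smul_zero]

end Ambient

/-! ### Vector bundles and connections along a map -/

section Along

variable {m n : ℕ} {M N : Type*}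
  [TopologicalSpace M] [ChartedSpace (EuclideanSpace ℝ (Fin m)) M] [IsManifold (𝓡 m) ∞ M]
  [TopologicalSpace N] [ChartedSpace (EuclideanSpace ℝ (Fin n)) N] [IsManifold (𝓡 n) ∞ N]

/-- Vector fields on `M`. -/
abbrev Field (m : ℕ) (M : Type*) [TopologicalSpace M]
    [ChartedSpace (EuclideanSpace ℝ (Fin m)) M] :=
  Π x : M, TangentSpace (𝓡 m) x

/-- Smoothness of a vector field on `M`. -/
def IsSmoothField (W : Field m M) : Prop :=
  ContMDiff (𝓡 m) (𝓡 m).tangent ∞ (fun x ↦ (⟨x, W x⟩ : TangentBundle (𝓡 m) M))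

/-- Sections of `TN|_M`, the pull-back of `TN` along `f : M → N`. -/
abbrev FieldAlong (n : ℕ) {M N : Type*} [TopologicalSpace N]
    [ChartedSpace (EuclideanSpace ℝ (Fin n)) N] (f : M → N) :=
  Π x : M, TangentSpace (𝓡 n) (f x)

/-- Fields of subspaces of `TN|_M`. -/
abbrev SubspaceFieldAlong (n : ℕ) {M N : Type*} [TopologicalSpace N]
    [ChartedSpace (EuclideanSpace ℝ (Fin n)) N] (f : M → N) :=
  Π x : M, Submodule ℝ (TangentSpace (𝓡 n) (f x))

/-- A field of subspaces of `TN|_M` is a smooth vector subbundle when it has smooth local frames. -/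
def IsSmoothSubbundle (m : ℕ) [ChartedSpace (EuclideanSpace ℝ (Fin m)) M]
    (f : M → N) (A : SubspaceFieldAlong n f) : Prop :=
  ∀ x₀ : M, ∃ U : Set M, IsOpen U ∧ x₀ ∈ U ∧ ∃ (k : ℕ) (s : Fin k → FieldAlong n f),
    (∀ i, ContMDiffOn (𝓡 m) (𝓡 n).tangent ∞
      (fun x ↦ (⟨f x, s i x⟩ : TangentBundle (𝓡 n) N)) U) ∧
    ∀ x ∈ U, LinearIndependent ℝ (fun i ↦ s i x) ∧
      Submodule.span ℝ (Set.range fun i ↦ s i x) = A x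

/-- A vector field on `M`, seen as a section of `TN|_M` through the differential of `f`. -/
def push (f : M → N) (W : Field m M) : FieldAlong n f :=
  fun x ↦ mfderiv (𝓡 m) (𝓡 n) f x (W x)

/-- `P V` for a section `V` of `TN|_M`. -/
def GoldenStructure.app {g : SemiRiemannianMetric n N} (G : GoldenStructure g) {f : M → N}
    (V : FieldAlong n f) : FieldAlong n f :=
  fun x ↦ G.P (f x) (V x)

/-- The connection `D` of `N` acting on sections of `TN|_M`: `covAlong D f V x w` is `(D_w V)(x)`,
for `w` tangent to `M` at `x`.  In the coordinate frame `(∂ᵢ)` of the chart of `N` centred at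
`f x`, with `V = ∑ᵢ vⁱ (∂ᵢ ∘ f)` near `x`, it is `∑ᵢ (w vⁱ) ∂ᵢ + D_{df w} (∑ᵢ vⁱ(x) ∂ᵢ)`;
`FiberBundle.extend` is the vector field with constant coefficients `vⁱ(x)` in that frame. -/
def covAlong (D : LinearConnection n N) (f : M → N) (V : FieldAlong n f) (x : M)
    (w : TangentSpace (𝓡 m) x) : TangentSpace (𝓡 n) (f x) :=
  (trivializationAt (EuclideanSpace ℝ (Fin n)) (TangentSpace (𝓡 n) : N → Type _) (f x)).symm (f x)
    (mvfderiv (𝓡 m) (fun y : M ↦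
      (trivializationAt (EuclideanSpace ℝ (Fin n)) (TangentSpace (𝓡 n) : N → Type _) (f x)
        ⟨f y, V y⟩).2) x w) +
  D (FiberBundle.extend (EuclideanSpace ℝ (Fin n)) (V x)) (f x) (mfderiv (𝓡 m) (𝓡 n) f x w)

/-- The tangent space of `M` at `x`, as a subspace of `T_{f x} N`. -/
def tangent (m : ℕ) [ChartedSpace (EuclideanSpace ℝ (Fin m)) M] (f : M → N) :
    SubspaceFieldAlong n f :=
  fun x ↦ (mfderiv (𝓡 m) (𝓡 n) f x).toLinearMap.range

/-- The radical distribution `Rad TM = TM ∩ TM^⊥`. -/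
def rad (m : ℕ) [ChartedSpace (EuclideanSpace ℝ (Fin m)) M] (g : SemiRiemannianMetric n N)
    (f : M → N) : SubspaceFieldAlong n f :=
  fun x ↦ tangent m f x ⊓ g.orth (tangent m f x)

open Classical in
/-- The projection onto `A` along `B`, when `A` and `B` are complementary subspaces. -/
def projAlong {V : Type*} [AddCommGroup V] [Module ℝ V] (A B : Submodule ℝ V) : V →ₗ[ℝ] V :=
  if h : IsCompl A B then Submodule.projection A B h else 0

/-! ### Lightlike submanifolds -/

/-- An `r`-lightlike immersed submanifold `f : M → N` of `(N, g)`, with `r ≥ 1`, together with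
a screen distribution `S(TM)`, a screen transversal bundle `S(TM^⊥)` and a transversal bundle
`ltr(TM)`, so that
`TN|_M = S(TM) ⊥ [Rad TM ⊕ ltr(TM)] ⊥ S(TM^⊥)`.
All the bundles are given as subbundles of `TN|_M`. The bundle `ltr(TM)` is not asked to be totally
null; the case in which it is totally null is included. -/
structure LightlikeSubmanifold (m : ℕ) (M : Type*) [TopologicalSpace M]
    [ChartedSpace (EuclideanSpace ℝ (Fin m)) M] [IsManifold (𝓡 m) ∞ M]
    (g : SemiRiemannianMetric n N) (r : ℕ) where
  f : M → N
  smooth : ContMDiff (𝓡 m) (𝓡 n) ∞ f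
  immersion (x : M) : Function.Injective (mfderiv (𝓡 m) (𝓡 n) f x)
  one_le : 1 ≤ r
  rad_smooth : IsSmoothSubbundle m f (rad m g f)
  rad_rank (x : M) : Module.finrank ℝ (rad m g f x) = r
  /-- `S(TM)` -/
  screen : SubspaceFieldAlong n f
  screen_smooth : IsSmoothSubbundle m f screen
  screen_inf (x : M) : screen x ⊓ rad m g f x = ⊥
  screen_sup (x : M) : screen x ⊔ rad m g f x = tangent m f x
  /-- `S(TM^⊥)` -/
  str : SubspaceFieldAlong n f
  str_smooth : IsSmoothSubbundle m f str
  str_inf (x : M) : str x ⊓ rad m g f x = ⊥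
  str_sup (x : M) : str x ⊔ rad m g f x = g.orth (tangent m f x)
  /-- `ltr(TM)` -/
  ltr : SubspaceFieldAlong n f
  ltr_smooth : IsSmoothSubbundle m f ltr
  ltr_inf (x : M) : ltr x ⊓ rad m g f x = ⊥
  ltr_sup (x : M) : ltr x ⊔ rad m g f x = g.orth (screen x ⊔ str x)

namespace LightlikeSubmanifold

variable {g : SemiRiemannianMetric n N} {r : ℕ} (L : LightlikeSubmanifold m M g r)

/-- Projection of `TN|_M = TM ⊕ tr(TM)` onto `TM`, where `tr(TM) = ltr(TM) ⊥ S(TM^⊥)`. -/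
def projTangent (x : M) : TangentSpace (𝓡 n) (L.f x) →ₗ[ℝ] TangentSpace (𝓡 n) (L.f x) :=
  projAlong (tangent m L.f x) (L.ltr x ⊔ L.str x)

/-- Projection of `TN|_M` onto `Rad TM` along the other three summands. -/
def projRad (x : M) : TangentSpace (𝓡 n) (L.f x) →ₗ[ℝ] TangentSpace (𝓡 n) (L.f x) :=
  projAlong (rad m g L.f x) (L.screen x ⊔ L.ltr x ⊔ L.str x)

/-- Projection of `TN|_M` onto `S(TM)` along the other three summands. -/
def projScreen (x : M) : TangentSpace (𝓡 n) (L.f x) →ₗ[ℝ] TangentSpace (𝓡 n) (L.f x) :=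
  projAlong (L.screen x) (rad m g L.f x ⊔ L.ltr x ⊔ L.str x)

/-- Projection of `TN|_M` onto `ltr(TM)` along the other three summands. -/
def projLtr (x : M) : TangentSpace (𝓡 n) (L.f x) →ₗ[ℝ] TangentSpace (𝓡 n) (L.f x) :=
  projAlong (L.ltr x) (L.screen x ⊔ rad m g L.f x ⊔ L.str x)

/-- Projection of `TN|_M` onto `S(TM^⊥)` along the other three summands. -/
def projStr (x : M) : TangentSpace (𝓡 n) (L.f x) →ₗ[ℝ] TangentSpace (𝓡 n) (L.f x) :=
  projAlong (L.str x) (L.screen x ⊔ rad m g L.f x ⊔ L.ltr x)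

/-- The smooth vector fields on `M` that are tangent to the distribution `A`. -/
def IsSectionOf (A : SubspaceFieldAlong n L.f) (W : Field m M) : Prop :=
  IsSmoothField W ∧ ∀ x, push L.f W x ∈ A x

/-- The induced connection `∇_W U`, the tangential part of `D_W U` (as a section of `TN|_M`). -/
def inducedConnection (D : LinearConnection n N) (W U : Field m M) : FieldAlong n L.f :=
  fun x ↦ L.projTangent x (covAlong D L.f (push L.f U) x (W x))

/-- `hˡ(W, U)`, the `ltr(TM)`-part of `D_W U`. -/
def hl (D : LinearConnection n N) (W U : Field m M) : FieldAlong n L.f :=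
  fun x ↦ L.projLtr x (covAlong D L.f (push L.f U) x (W x))

/-- `hˢ(W, U)`, the `S(TM^⊥)`-part of `D_W U`. -/
def hs (D : LinearConnection n N) (W U : Field m M) : FieldAlong n L.f :=
  fun x ↦ L.projStr x (covAlong D L.f (push L.f U) x (W x))

/-- The shape operator `A_V W`: `-A_V W` is the tangential part of `D_W V`, for a section `V` of
the transversal bundle `tr(TM)`. -/
def shape (D : LinearConnection n N) (V : FieldAlong n L.f) (W : Field m M) : FieldAlong n L.f :=
  fun x ↦ - L.projTangent x (covAlong D L.f V x (W x))

/-- `K₂ P hˡ(W, U)`, the `Rad TM`-part of `P hˡ(W, U)`. -/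
def K₂Phl (G : GoldenStructure g) (D : LinearConnection n N) (W U : Field m M) :
    FieldAlong n L.f :=
  fun x ↦ L.projRad x (G.app (L.hl D W U) x)

/-- `M₁ hˢ(W, U)`, the `S(TM)`-part of `P hˢ(W, U)`. -/
def M₁hs (G : GoldenStructure g) (D : LinearConnection n N) (W U : Field m M) :
    FieldAlong n L.f :=
  fun x ↦ L.projScreen x (G.app (L.hs D W U) x)

/-- A distribution `A ⊆ TM` defines a totally geodesic foliation on `M`: it is involutive, and
`∇_W U` is tangent to `A` whenever `W` and `U` are. -/
def DefinesTotallyGeodesicFoliation (D : LinearConnection n N) (A : SubspaceFieldAlong n L.f) :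
    Prop :=
  (∀ W U : Field m M, L.IsSectionOf A W → L.IsSectionOf A U →
    ∀ x, push L.f (VectorField.mlieBracket (𝓡 m) W U) x ∈ A x) ∧
  (∀ W U : Field m M, L.IsSectionOf A W → L.IsSectionOf A U →
    ∀ x, L.inducedConnection D W U x ∈ A x)

/-- Transversal lightlike submanifolds of a Golden semi-Riemannian manifold:
`P (Rad TM) = ltr(TM)` and `P (S(TM)) ⊆ S(TM^⊥)`. -/
structure IsTransversal (G : GoldenStructure g) : Prop where
  map_rad (x : M) : (rad m g L.f x).map (G.P (L.f x)).toLinearMap = L.ltr x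
  map_screen (x : M) : (L.screen x).map (G.P (L.f x)).toLinearMap ≤ L.str x

end LightlikeSubmanifold

end Along

end GoldenLightlike

end

namespace GoldenLightlike

/-! ### Linear algebra of the four-fold decomposition -/

section Algebra

variable {V : Type*} [AddCommGroup V] [Module ℝ V]

/-! Write `S`, `R`, `K`, `T` for the screen, the radical, ltr and the screen transversal bundle at a
point. `R` is orthogonal to `S`, `R` and `T`, so it pairs only with `K`, and that pairing detects
every vector of `K`; `S` is nondegenerate and orthogonal to the other three summands. No nullity of
`K` enters. In fact it would be incompatible with `P R = K`: for `ξ`, `η` in `R` the Golden relation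
gives `g(Pξ, Pη) = g(Pξ, η)`, and this form is nondegenerate on `R`.

For `W`, `U` in the radical and `Z` in the screen, differentiating `g(U, Z) = 0` gives `g(D_W U, Z)
= - g(U, D_W Z)` (`val_covAlong_eq_neg`). The left side vanishes for all `Z` exactly when `∇_W U`
lies in `R`; the right side vanishes for all `U` exactly when `hˡ(W, Z) = 0`. So the connection
condition amounts to `hˡ(W, Z) = 0` (`inducedConnection_mem_rad_iff_hl`), and involutivity follows
from it by vanishing torsion (`definesTotallyGeodesicFoliation_iff`).

Since `P` is parallel, `D_W (PZ) = P (D_W Z)`. Split `D_W Z = s + ρ + k + t` with `k = Pξ`. Then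
`Ps` is in `T`, `Pρ` is in `K`, `Pk = k + ξ`, and compatibility with the Golden relation puts `Pt`
in `S ⊕ T`. Hence the tangential part of `P (D_W Z)` is `M₁ hˢ + ξ`, where `ξ = K₂ P hˡ` is its
radical part, and `ξ = 0` exactly when `k = 0` (`projTangent_P`, `projR_P_projK_eq_zero_iff`).

The analytic work transfers the metric, parallel and torsion-free identities from `D` to fields
defined only along `f`, and extends single vectors to global sections. -/

lemma projAlong_apply_of_mem {A C : Submodule ℝ V} (h : IsCompl A C) {a c : V} (ha : a ∈ A)
    (hc : c ∈ C) : projAlong A C (a + c) = a := by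
  simp [projAlong, h, Submodule.projection_apply_of_mem_left h ha,
    Submodule.projection_apply_of_mem_right h hc]

/-- The decomposition `V = S ⊥ [R ⊕ K] ⊥ T` of a semi-Euclidean vector space in which `R` is the
radical of the subspace `S ⊔ R` and `T` is a complement of `R` in `(S ⊔ R)^⊥`. -/
structure IsLightlikeDecomposition (B : LinearMap.BilinForm ℝ V) (S R K T : Submodule ℝ V) :
    Prop where
  symm : ∀ u v, B u v = B v u
  nondegenerate : ∀ u, (∀ v, B u v = 0) → u = 0
  rad : R = (S ⊔ R) ⊓ B.orthogonal (S ⊔ R)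
  S_inf : S ⊓ R = ⊥
  T_inf : T ⊓ R = ⊥
  T_sup : T ⊔ R = B.orthogonal (S ⊔ R)
  K_inf : K ⊓ R = ⊥
  K_sup : K ⊔ R = B.orthogonal (S ⊔ T)

namespace IsLightlikeDecomposition

variable {B : LinearMap.BilinForm ℝ V} {S R K T : Submodule ℝ V}
  (h : IsLightlikeDecomposition B S R K T)
include h

lemma isRefl : B.IsRefl := fun u v huv ↦ by rw [h.symm, huv]

lemma R_le_orthogonal : R ≤ B.orthogonal (S ⊔ R) := h.rad.le.trans inf_le_right

lemma T_le_orthogonal : T ≤ B.orthogonal (S ⊔ R) := le_sup_left.trans h.T_sup.le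

lemma K_le_orthogonal : K ≤ B.orthogonal (S ⊔ T) := le_sup_left.trans h.K_sup.le

lemma S_R {s ρ : V} (hs : s ∈ S) (hρ : ρ ∈ R) : B s ρ = 0 :=
  h.R_le_orthogonal hρ s (Submodule.mem_sup_left hs)

lemma R_R {ρ ρ' : V} (hρ : ρ ∈ R) (hρ' : ρ' ∈ R) : B ρ ρ' = 0 :=
  h.R_le_orthogonal hρ' ρ (Submodule.mem_sup_right hρ)

lemma S_T {s t : V} (hs : s ∈ S) (ht : t ∈ T) : B s t = 0 :=
  h.T_le_orthogonal ht s (Submodule.mem_sup_left hs)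

lemma R_T {ρ t : V} (hρ : ρ ∈ R) (ht : t ∈ T) : B ρ t = 0 :=
  h.T_le_orthogonal ht ρ (Submodule.mem_sup_right hρ)

lemma S_K {s k : V} (hs : s ∈ S) (hk : k ∈ K) : B s k = 0 :=
  h.K_le_orthogonal hk s (Submodule.mem_sup_left hs)

lemma T_K {t k : V} (ht : t ∈ T) (hk : k ∈ K) : B t k = 0 :=
  h.K_le_orthogonal hk t (Submodule.mem_sup_right ht)

/-- Orthogonality to `R` is automatic inside `S ⊔ R`, so membership in the radical need only be
tested against `S`. -/
lemma mem_R_of_forall {u : V} (hu : u ∈ S ⊔ R) (hS : ∀ s ∈ S, B s u = 0) : u ∈ R := by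
  rw [h.rad]
  refine ⟨hu, fun w hw ↦ ?_⟩
  obtain ⟨s, hs, ρ, hρ, rfl⟩ := Submodule.mem_sup.1 hw
  obtain ⟨s', hs', ρ', hρ', rfl⟩ := Submodule.mem_sup.1 hu
  have : B ρ (s' + ρ') = 0 := by
    rw [map_add, h.symm, h.S_R hs' hρ, h.R_R hρ hρ', add_zero]
  show B (s + ρ) (s' + ρ') = 0
  rw [LinearMap.map_add₂, hS s hs, this, add_zero]

lemma S_nondegenerate {s : V} (hs : s ∈ S) (hS : ∀ s' ∈ S, B s' s = 0) : s = 0 := by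
  have : s ∈ S ⊓ R := ⟨hs, h.mem_R_of_forall (Submodule.mem_sup_left hs) hS⟩
  simpa [h.S_inf] using this

lemma bilin_nondegenerate : B.Nondegenerate :=
  h.isRefl.nondegenerate_iff_separatingLeft.2 h.nondegenerate

variable [FiniteDimensional ℝ V]

/-- Double orthogonal complement in finite dimension: `T ⊔ R` is `(S ⊔ R)^⊥`, so its own orthogonal
is `S ⊔ R`. -/
lemma mem_tangent_of_forall {u : V} (hT : ∀ t ∈ T, B t u = 0) (hR : ∀ ρ ∈ R, B ρ u = 0) :
    u ∈ S ⊔ R := by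
  rw [← LinearMap.BilinForm.orthogonal_orthogonal h.bilin_nondegenerate h.isRefl (S ⊔ R),
    ← h.T_sup]
  intro w hw
  obtain ⟨t, ht, ρ, hρ, rfl⟩ := Submodule.mem_sup.1 hw
  show B (t + ρ) u = 0
  rw [LinearMap.map_add₂, hT t ht, hR ρ hρ, add_zero]

/-- Such a `t` is orthogonal to `T` and `R`, hence tangent; being orthogonal to `S` as well, it is
radical, and `T` meets `R` trivially. -/
lemma T_nondegenerate {t : V} (ht : t ∈ T) (hT : ∀ t' ∈ T, B t' t = 0) : t = 0 := by
  have h1 : t ∈ S ⊔ R := h.mem_tangent_of_forall hT fun ρ hρ ↦ h.R_T hρ ht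
  have : t ∈ T ⊓ R := ⟨ht, h.mem_R_of_forall h1 fun s hs ↦ h.S_T hs ht⟩
  simpa [h.T_inf] using this

/-- Pairing the relation with `S` isolates `s` and pairing with `T` isolates `t`; what remains lies
in `K ⊓ R`. -/
lemma eq_zero_of_sum_eq_zero {s ρ k t : V} (hs : s ∈ S) (hρ : ρ ∈ R) (hk : k ∈ K) (ht : t ∈ T)
    (e : s + ρ + k + t = 0) : s = 0 ∧ ρ = 0 ∧ k = 0 ∧ t = 0 := by
  have hs0 : s = 0 := h.S_nondegenerate hs fun s' hs' ↦ by
    have := congrArg (B s') e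
    simpa [h.S_R hs' hρ, h.S_K hs' hk, h.S_T hs' ht] using this
  have ht0 : t = 0 := h.T_nondegenerate ht fun t' ht' ↦ by
    have := congrArg (B t') e
    simpa [h.symm t' s, h.symm t' ρ, h.S_T hs ht', h.R_T hρ ht', h.T_K ht' hk] using this
  subst hs0 ht0
  have hk' : k = -ρ := by
    rw [zero_add, add_zero] at e
    exact eq_neg_of_add_eq_zero_right e
  have : k ∈ K ⊓ R := ⟨hk, hk' ▸ R.neg_mem hρ⟩
  have hk0 : k = 0 := by simpa [h.K_inf] using this
  refine ⟨rfl, ?_, hk0, rfl⟩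
  simpa [hk0] using hk'

/-- `S ⊔ T` is nondegenerate, so the space splits as `S ⊔ T` plus its orthogonal, which is `K ⊔ R`.
-/
lemma exists_components (v : V) : ∃ s ∈ S, ∃ ρ ∈ R, ∃ k ∈ K, ∃ t ∈ T, v = s + ρ + k + t := by
  have hd : Disjoint (S ⊔ T) (B.orthogonal (S ⊔ T)) := by
    rw [Submodule.disjoint_def]
    intro u hu hu'
    obtain ⟨s, hs, t, ht, rfl⟩ := Submodule.mem_sup.1 hu
    have hs0 : s = 0 := h.S_nondegenerate hs fun s' hs' ↦ by
      have : B s' (s + t) = 0 := hu' s' (Submodule.mem_sup_left hs')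
      simpa [h.S_T hs' ht] using this
    have ht0 : t = 0 := h.T_nondegenerate ht fun t' ht' ↦ by
      have : B t' (s + t) = 0 := hu' t' (Submodule.mem_sup_right ht')
      simpa [h.symm t' s, h.S_T hs ht'] using this
    simp [hs0, ht0]
  have hc := (LinearMap.BilinForm.isCompl_orthogonal_iff_disjoint h.isRefl).2 hd
  have hv : v ∈ (S ⊔ T) ⊔ (K ⊔ R) := by
    rw [h.K_sup, hc.sup_eq_top]; trivial
  obtain ⟨a, ha, b, hb, rfl⟩ := Submodule.mem_sup.1 hv
  obtain ⟨s, hs, t, ht, rfl⟩ := Submodule.mem_sup.1 ha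
  obtain ⟨k, hk, ρ, hρ, rfl⟩ := Submodule.mem_sup.1 hb
  exact ⟨s, hs, ρ, hρ, k, hk, t, ht, by abel⟩

/-! ### Complementary summands and the resulting component formulas. -/

lemma isCompl_tangent : IsCompl (S ⊔ R) (K ⊔ T) := by
  constructor
  · rw [Submodule.disjoint_def]
    intro u hu hu'
    obtain ⟨s, hs, ρ, hρ, rfl⟩ := Submodule.mem_sup.1 hu
    obtain ⟨k, hk, t, ht, e⟩ := Submodule.mem_sup.1 hu'
    obtain ⟨h1, h2, -, -⟩ := h.eq_zero_of_sum_eq_zero hs hρ (K.neg_mem hk) (T.neg_mem ht)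
      (by rw [← e]; abel)
    simp [h1, h2]
  · rw [codisjoint_iff, eq_top_iff]
    intro v _
    obtain ⟨s, hs, ρ, hρ, k, hk, t, ht, rfl⟩ := h.exists_components v
    rw [add_assoc (s + ρ)]
    exact Submodule.add_mem_sup (Submodule.add_mem_sup hs hρ) (Submodule.add_mem_sup hk ht)

lemma isCompl_R : IsCompl R (S ⊔ K ⊔ T) := by
  constructor
  · rw [Submodule.disjoint_def]
    intro ρ hρ hu'
    obtain ⟨a, ha, t, ht, e⟩ := Submodule.mem_sup.1 hu'
    obtain ⟨s, hs, k, hk, rfl⟩ := Submodule.mem_sup.1 ha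
    exact (h.eq_zero_of_sum_eq_zero (S.neg_mem hs) hρ (K.neg_mem hk) (T.neg_mem ht)
      (by rw [← e]; abel)).2.1
  · rw [codisjoint_iff, eq_top_iff]
    intro v _
    obtain ⟨s, hs, ρ, hρ, k, hk, t, ht, rfl⟩ := h.exists_components v
    rw [show s + ρ + k + t = ρ + (s + k + t) by abel]
    exact Submodule.add_mem_sup hρ (Submodule.add_mem_sup (Submodule.add_mem_sup hs hk) ht)

lemma isCompl_S : IsCompl S (R ⊔ K ⊔ T) := by
  constructor
  · rw [Submodule.disjoint_def]
    intro s hs hu'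
    obtain ⟨a, ha, t, ht, e⟩ := Submodule.mem_sup.1 hu'
    obtain ⟨ρ, hρ, k, hk, rfl⟩ := Submodule.mem_sup.1 ha
    exact (h.eq_zero_of_sum_eq_zero hs (R.neg_mem hρ) (K.neg_mem hk) (T.neg_mem ht)
      (by rw [← e]; abel)).1
  · rw [codisjoint_iff, eq_top_iff]
    intro v _
    obtain ⟨s, hs, ρ, hρ, k, hk, t, ht, rfl⟩ := h.exists_components v
    rw [show s + ρ + k + t = s + (ρ + k + t) by abel]
    exact Submodule.add_mem_sup hs (Submodule.add_mem_sup (Submodule.add_mem_sup hρ hk) ht)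

lemma isCompl_K : IsCompl K (S ⊔ R ⊔ T) := by
  constructor
  · rw [Submodule.disjoint_def]
    intro k hk hu'
    obtain ⟨a, ha, t, ht, e⟩ := Submodule.mem_sup.1 hu'
    obtain ⟨s, hs, ρ, hρ, rfl⟩ := Submodule.mem_sup.1 ha
    exact (h.eq_zero_of_sum_eq_zero (S.neg_mem hs) (R.neg_mem hρ) hk (T.neg_mem ht)
      (by rw [← e]; abel)).2.2.1
  · rw [codisjoint_iff, eq_top_iff]
    intro v _
    obtain ⟨s, hs, ρ, hρ, k, hk, t, ht, rfl⟩ := h.exists_components v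
    rw [show s + ρ + k + t = k + (s + ρ + t) by abel]
    exact Submodule.add_mem_sup hk (Submodule.add_mem_sup (Submodule.add_mem_sup hs hρ) ht)

lemma isCompl_T : IsCompl T (S ⊔ R ⊔ K) := by
  constructor
  · rw [Submodule.disjoint_def]
    intro t ht hu'
    obtain ⟨a, ha, k, hk, e⟩ := Submodule.mem_sup.1 hu'
    obtain ⟨s, hs, ρ, hρ, rfl⟩ := Submodule.mem_sup.1 ha
    exact (h.eq_zero_of_sum_eq_zero (S.neg_mem hs) (R.neg_mem hρ) (K.neg_mem hk) ht
      (by rw [← e]; abel)).2.2.2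
  · rw [codisjoint_iff, eq_top_iff]
    intro v _
    obtain ⟨s, hs, ρ, hρ, k, hk, t, ht, rfl⟩ := h.exists_components v
    rw [show s + ρ + k + t = t + (s + ρ + k) by abel]
    exact Submodule.add_mem_sup ht (Submodule.add_mem_sup (Submodule.add_mem_sup hs hρ) hk)

section Components

variable {s ρ k t : V} (hs : s ∈ S) (hρ : ρ ∈ R) (hk : k ∈ K) (ht : t ∈ T)
include hs hρ hk ht

lemma projAlong_tangent : projAlong (S ⊔ R) (K ⊔ T) (s + ρ + k + t) = s + ρ := by
  rw [add_assoc (s + ρ)]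
  exact projAlong_apply_of_mem h.isCompl_tangent (Submodule.add_mem_sup hs hρ)
    (Submodule.add_mem_sup hk ht)

lemma projAlong_R : projAlong R (S ⊔ K ⊔ T) (s + ρ + k + t) = ρ := by
  rw [show s + ρ + k + t = ρ + (s + k + t) by abel]
  exact projAlong_apply_of_mem h.isCompl_R hρ
    (Submodule.add_mem_sup (Submodule.add_mem_sup hs hk) ht)

lemma projAlong_S : projAlong S (R ⊔ K ⊔ T) (s + ρ + k + t) = s := by
  rw [show s + ρ + k + t = s + (ρ + k + t) by abel]
  exact projAlong_apply_of_mem h.isCompl_S hs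
    (Submodule.add_mem_sup (Submodule.add_mem_sup hρ hk) ht)

lemma projAlong_K : projAlong K (S ⊔ R ⊔ T) (s + ρ + k + t) = k := by
  rw [show s + ρ + k + t = k + (s + ρ + t) by abel]
  exact projAlong_apply_of_mem h.isCompl_K hk
    (Submodule.add_mem_sup (Submodule.add_mem_sup hs hρ) ht)

lemma projAlong_T : projAlong T (S ⊔ R ⊔ K) (s + ρ + k + t) = t := by
  rw [show s + ρ + k + t = t + (s + ρ + k) by abel]
  exact projAlong_apply_of_mem h.isCompl_T ht
    (Submodule.add_mem_sup (Submodule.add_mem_sup hs hρ) hk)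

end Components

/-- `K` is already orthogonal to `S` and `T`. A vector of `K` that is also orthogonal to `R` is
therefore tangent, then radical, and `K ⊓ R` is trivial. -/
lemma eq_zero_of_mem_K {k : V} (hk : k ∈ K) (hR : ∀ ρ ∈ R, B ρ k = 0) : k = 0 := by
  have h1 : k ∈ S ⊔ R := h.mem_tangent_of_forall (fun t ht ↦ h.T_K ht hk) hR
  have : k ∈ K ⊓ R := ⟨hk, h.mem_R_of_forall h1 fun s hs ↦ h.S_K hs hk⟩
  simpa [h.K_inf] using this

lemma R_eq_R_projK {ρ : V} (hρ : ρ ∈ R) (v : V) : B ρ v = B ρ (projAlong K (S ⊔ R ⊔ T) v) := by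
  obtain ⟨s, hs, ρ', hρ', k, hk, t, ht, rfl⟩ := h.exists_components v
  rw [h.projAlong_K hs hρ' hk ht]
  simp [h.symm ρ s, h.S_R hs hρ, h.R_R hρ hρ', h.R_T hρ ht]

lemma projK_eq_zero_iff (v : V) : projAlong K (S ⊔ R ⊔ T) v = 0 ↔ ∀ ρ ∈ R, B ρ v = 0 := by
  refine ⟨fun hv ρ hρ ↦ by rw [h.R_eq_R_projK hρ, hv, map_zero], fun hv ↦ ?_⟩
  refine h.eq_zero_of_mem_K ?_ fun ρ hρ ↦ by rw [← h.R_eq_R_projK hρ, hv ρ hρ]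
  obtain ⟨s, hs, ρ', hρ', k, hk, t, ht, rfl⟩ := h.exists_components v
  rwa [h.projAlong_K hs hρ' hk ht]

lemma projTangent_of_mem {v : V} (hv : v ∈ S ⊔ R) : projAlong (S ⊔ R) (K ⊔ T) v = v := by
  simpa using projAlong_apply_of_mem h.isCompl_tangent hv (Submodule.zero_mem _)

/-- Only the `S`-component of `v` pairs with `S`, and `S` is nondegenerate. -/
lemma projTangent_mem_R_iff (v : V) :
    projAlong (S ⊔ R) (K ⊔ T) v ∈ R ↔ ∀ s ∈ S, B s v = 0 := by
  obtain ⟨s, hs, ρ, hρ, k, hk, t, ht, rfl⟩ := h.exists_components v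
  rw [h.projAlong_tangent hs hρ hk ht]
  refine ⟨fun hm s' hs' ↦ ?_, fun hm ↦ ?_⟩
  · have := h.S_R hs' hm
    simpa [h.S_K hs' hk, h.S_T hs' ht] using this
  · refine h.mem_R_of_forall (Submodule.add_mem_sup hs hρ) fun s' hs' ↦ ?_
    have := hm s' hs'
    simpa [h.S_K hs' hk, h.S_T hs' ht] using this

/-! ### Action of the Golden structure on the four summands. -/

section Golden

variable {P : V →ₗ[ℝ] V} (golden : ∀ u, P (P u) = P u + u)
  (compatible : ∀ u v, B (P u) v = B u (P v))
  (map_R : R.map P = K) (map_S : S.map P ≤ T)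

include golden compatible map_R in
-- The `K`-component of `Pt` is seen by `R`, and the `R`-component by `K = P R`; compatibility moves
-- `P` to the other argument, where `T ⊥ K` and `T ⊥ R` apply.
lemma exists_components_of_mem_T {t : V} (ht : t ∈ T) :
    ∃ s ∈ S, ∃ t' ∈ T, P t = s + t' := by
  obtain ⟨s, hs, ρ, hρ, k, hk, t', ht', e⟩ := h.exists_components (P t)
  have hk0 : k = 0 := by
    refine h.eq_zero_of_mem_K hk fun ρ' hρ' ↦ ?_
    have h1 : B ρ' (P t) = 0 := by
      rw [← compatible, h.symm]
      exact h.T_K ht (map_R ▸ Submodule.mem_map_of_mem hρ')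
    rw [e] at h1
    simpa [h.symm ρ' s, h.S_R hs hρ', h.R_R hρ' hρ, h.R_T hρ' ht'] using h1
  have hρ0 : ρ = 0 := by
    refine h.nondegenerate ρ fun v ↦ ?_
    obtain ⟨s₁, hs₁, ρ₁, hρ₁, k₁, hk₁, t₁, ht₁, rfl⟩ := h.exists_components v
    obtain ⟨ξ, hξ, rfl⟩ : ∃ ξ ∈ R, P ξ = k₁ := by simpa [← map_R] using hk₁
    -- `g(Pξ, Pt) = g(P²ξ, t) = g(Pξ, t) + g(ξ, t)`, and both terms vanish.
    have h1 : B (P ξ) (P t) = 0 := by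
      rw [← compatible, golden, LinearMap.map_add₂, h.symm, h.T_K ht hk₁, h.R_T hξ ht, add_zero]
    rw [e] at h1
    have h2 : B (P ξ) ρ = 0 := by
      simpa [hk0, h.symm (P ξ) s, h.S_K hs hk₁, h.symm (P ξ) t', h.T_K ht' hk₁] using h1
    simp [h.symm ρ s₁, h.S_R hs₁ hρ, h.R_R hρ hρ₁, h.symm ρ (P ξ), h2, h.R_T hρ ht₁]
  exact ⟨s, hs, t', ht', by simpa [hk0, hρ0] using e⟩

include golden map_R in
-- With `k = Pξ`, the relation `Pk = k + ξ` shows that the radical part of `Pk` is `ξ`; `P` is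
-- injective on such `ξ` by the Golden relation.
lemma projR_P_projK_eq_zero_iff (v : V) :
    projAlong R (S ⊔ K ⊔ T) (P (projAlong K (S ⊔ R ⊔ T) v)) = 0 ↔
      projAlong K (S ⊔ R ⊔ T) v = 0 := by
  obtain ⟨s, hs, ρ, hρ, k, hk, t, ht, rfl⟩ := h.exists_components v
  rw [h.projAlong_K hs hρ hk ht]
  obtain ⟨ξ, hξ, rfl⟩ : ∃ ξ ∈ R, P ξ = k := by simpa [← map_R] using hk
  have : P (P ξ) = 0 + ξ + P ξ + 0 := by rw [golden]; abel
  rw [this, h.projAlong_R S.zero_mem hξ hk T.zero_mem]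
  refine ⟨fun e ↦ by rw [e, map_zero], fun e ↦ ?_⟩
  have := golden ξ
  rw [e] at this
  simpa using this.symm

include golden compatible map_R map_S in
-- `P` sends the tangential part of `v` into `K ⊔ T`, so tangential terms of `Pv` come only from `k`
-- (contributing to `R`) and from `t` (contributing to `S`).
lemma projTangent_P (v : V) :
    projAlong (S ⊔ R) (K ⊔ T) (P v) =
      projAlong S (R ⊔ K ⊔ T) (P (projAlong T (S ⊔ R ⊔ K) v)) +
      projAlong R (S ⊔ K ⊔ T) (P (projAlong K (S ⊔ R ⊔ T) v)) ∧
    projAlong R (S ⊔ K ⊔ T) (projAlong (S ⊔ R) (K ⊔ T) (P v)) =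
      projAlong R (S ⊔ K ⊔ T) (P (projAlong K (S ⊔ R ⊔ T) v)) := by
  obtain ⟨s, hs, ρ, hρ, k, hk, t, ht, rfl⟩ := h.exists_components v
  rw [h.projAlong_K hs hρ hk ht, h.projAlong_T hs hρ hk ht]
  obtain ⟨ξ, hξ, rfl⟩ : ∃ ξ ∈ R, P ξ = k := by simpa [← map_R] using hk
  obtain ⟨s', hs', t', ht', e⟩ := h.exists_components_of_mem_T golden compatible map_R ht
  have hPρ : P ρ ∈ K := map_R ▸ Submodule.mem_map_of_mem hρ
  have hPs : P s ∈ T := map_S (Submodule.mem_map_of_mem hs)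
  have e1 : P (P ξ) = 0 + ξ + P ξ + 0 := by rw [golden]; abel
  have e2 : P t = s' + 0 + 0 + t' := by rw [e]; abel
  have e3 : P (s + ρ + P ξ + t) = s' + ξ + (P ρ + P ξ) + (P s + t') := by
    simp only [map_add, golden, e]; abel
  have e4 : s' + ξ = s' + ξ + 0 + 0 := by abel
  rw [e3, h.projAlong_tangent hs' hξ (K.add_mem hPρ hk) (T.add_mem hPs ht'), e1,
    h.projAlong_R S.zero_mem hξ hk T.zero_mem, e2,
    h.projAlong_S hs' R.zero_mem K.zero_mem ht']
  refine ⟨rfl, ?_⟩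
  rw [e4, h.projAlong_R hs' hξ K.zero_mem T.zero_mem]

end Golden

end IsLightlikeDecomposition

end Algebra

/-! ### Derivatives of vector-valued functions on a manifold -/

section Calculus

variable {m : ℕ} {M : Type*} [TopologicalSpace M] [ChartedSpace (EuclideanSpace ℝ (Fin m)) M]
  {F G : Type*} [NormedAddCommGroup F] [NormedSpace ℝ F] [NormedAddCommGroup G] [NormedSpace ℝ G]

lemma mvfderiv_clm_apply {A : M → F →L[ℝ] G} {b : M → F} {x : M}
    (hA : MDifferentiableAt (𝓡 m) 𝓘(ℝ, F →L[ℝ] G) A x)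
    (hb : MDifferentiableAt (𝓡 m) 𝓘(ℝ, F) b x) (w : TangentSpace (𝓡 m) x) :
    mvfderiv (𝓡 m) (fun y ↦ A y (b y)) x w =
      mvfderiv (𝓡 m) A x w (b x) + A x (mvfderiv (𝓡 m) b x w) := by
  let A' : EuclideanSpace ℝ (Fin m) →L[ℝ] F →L[ℝ] G := mvfderiv (𝓡 m) A x
  let b' : EuclideanSpace ℝ (Fin m) →L[ℝ] F := mvfderiv (𝓡 m) b x
  have h : HasMFDerivAt (𝓡 m) 𝓘(ℝ, G) (fun y ↦ A y (b y)) x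
      ((A x).comp b' + A'.flip (b x)) := by
    refine ⟨ContinuousAt.clm_apply hA.continuousAt hb.continuousAt, ?_⟩
    have := HasFDerivWithinAt.clm_apply hA.hasMFDerivAt.2 hb.hasMFDerivAt.2
    simp only [writtenInExtChartAt, mfld_simps] at this ⊢
    exact this
  show mfderiv (𝓡 m) 𝓘(ℝ, G) (fun y ↦ A y (b y)) x w = _
  rw [h.mfderiv]
  exact add_comm (A x (mvfderiv (𝓡 m) b x w)) _

lemma mvfderiv_congr {a b : M → F} {x : M} (h : a =ᶠ[𝓝 x] b) :
    mvfderiv (𝓡 m) a x = mvfderiv (𝓡 m) b x := h.mfderiv_eq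

lemma mvfderiv_comp_manifold {n : ℕ} {N : Type*} [TopologicalSpace N]
    [ChartedSpace (EuclideanSpace ℝ (Fin n)) N] {f : M → N} {h : N → F} {x : M}
    (hh : MDifferentiableAt (𝓡 n) 𝓘(ℝ, F) h (f x)) (hf : MDifferentiableAt (𝓡 m) (𝓡 n) f x)
    (w : TangentSpace (𝓡 m) x) :
    mvfderiv (𝓡 m) (fun y ↦ h (f y)) x w = mvfderiv (𝓡 n) h (f x) (mfderiv (𝓡 m) (𝓡 n) f x w) :=
  mfderiv_comp_apply x hh hf w

end Calculus

/-! ### The tangent bundle in coordinates -/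

section Coordinates

variable {n : ℕ} {N : Type*} [TopologicalSpace N]
  [ChartedSpace (EuclideanSpace ℝ (Fin n)) N] [IsManifold (𝓡 n) ∞ N]

/-- The coordinates of the tangent vectors at `q` in the chart centred at `q₀`. -/
noncomputable def coord (q₀ q : N) : TangentSpace (𝓡 n) q →L[ℝ] EuclideanSpace ℝ (Fin n) :=
  (trivializationAt (EuclideanSpace ℝ (Fin n)) (TangentSpace (𝓡 n) : N → Type _)
    q₀).continuousLinearMapAt ℝ q

/-- The tangent vector at `q` with given coordinates in the chart centred at `q₀`. -/
noncomputable def coordSymm (q₀ q : N) : EuclideanSpace ℝ (Fin n) →L[ℝ] TangentSpace (𝓡 n) q :=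
  (trivializationAt (EuclideanSpace ℝ (Fin n)) (TangentSpace (𝓡 n) : N → Type _)
    q₀).symmL ℝ q

omit [IsManifold (𝓡 n) ∞ N] in
lemma eventually_mem_source (q₀ : N) :
    ∀ᶠ q in 𝓝 q₀, q ∈ (chartAt (EuclideanSpace ℝ (Fin n)) q₀).source :=
  (chartAt _ q₀).open_source.mem_nhds (mem_chart_source _ q₀)

lemma coord_eq {q₀ q : N} (hq : q ∈ (chartAt (EuclideanSpace ℝ (Fin n)) q₀).source)
    (v : TangentSpace (𝓡 n) q) :
    (trivializationAt (EuclideanSpace ℝ (Fin n)) (TangentSpace (𝓡 n) : N → Type _) q₀ ⟨q, v⟩).2 =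
      coord q₀ q v := by
  rw [coord, Trivialization.continuousLinearMapAt_apply,
    Trivialization.linearMapAt_apply, if_pos (by simpa using hq)]

lemma coord_coordSymm {q₀ q : N} (hq : q ∈ (chartAt (EuclideanSpace ℝ (Fin n)) q₀).source)
    (v : EuclideanSpace ℝ (Fin n)) : coord q₀ q (coordSymm q₀ q v) = v :=
  Trivialization.continuousLinearMapAt_symmL _ (by simpa using hq) v

lemma coordSymm_coord {q₀ q : N} (hq : q ∈ (chartAt (EuclideanSpace ℝ (Fin n)) q₀).source)
    (v : TangentSpace (𝓡 n) q) : coordSymm q₀ q (coord q₀ q v) = v :=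
  Trivialization.symmL_continuousLinearMapAt _ (by simpa using hq) v

lemma symm_eq_coordSymm {q₀ q : N} (hq : q ∈ (chartAt (EuclideanSpace ℝ (Fin n)) q₀).source)
    (v : EuclideanSpace ℝ (Fin n)) :
    (trivializationAt (EuclideanSpace ℝ (Fin n)) (TangentSpace (𝓡 n) : N → Type _) q₀).symm q v =
      coordSymm q₀ q v :=
  (Trivialization.symmL_apply _ (by simpa using hq) v).symm

lemma coord_eq_mvfderiv {q₀ q : N} (hq : q ∈ (chartAt (EuclideanSpace ℝ (Fin n)) q₀).source) :
    coord q₀ q = mvfderiv (𝓡 n) (extChartAt (𝓡 n) q₀) q := by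
  exact TangentBundle.continuousLinearMapAt_trivializationAt hq

lemma extend_eq {q₀ q : N} (hq : q ∈ (chartAt (EuclideanSpace ℝ (Fin n)) q₀).source)
    (v : TangentSpace (𝓡 n) q₀) :
    FiberBundle.extend (EuclideanSpace ℝ (Fin n)) v q = coordSymm q₀ q (coord q₀ q₀ v) := by
  rw [← coord_eq (mem_chart_source _ _), ← symm_eq_coordSymm hq, FiberBundle.extend]

variable {m : ℕ} {M : Type*} [TopologicalSpace M] [ChartedSpace (EuclideanSpace ℝ (Fin m)) M]

/-- Differentiability of a section along `f`, in coordinates. -/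
lemma mdifferentiableAt_along_iff {f : M → N} {V : FieldAlong n f} {x : M} :
    MDifferentiableAt (𝓡 m) (𝓡 n).tangent (fun y ↦ (⟨f y, V y⟩ : TangentBundle (𝓡 n) N)) x ↔
      MDifferentiableAt (𝓡 m) (𝓡 n) f x ∧
      MDifferentiableAt (𝓡 m) 𝓘(ℝ, EuclideanSpace ℝ (Fin n))
        (fun y ↦ coord (f x) (f y) (V y)) x := by
  rw [mdifferentiableAt_totalSpace]
  refine and_congr_right fun hf ↦ ?_
  have : (fun y ↦ (trivializationAt (EuclideanSpace ℝ (Fin n))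
      (TangentSpace (𝓡 n) : N → Type _) (f x) ⟨f y, V y⟩).2) =ᶠ[𝓝 x]
      fun y ↦ coord (f x) (f y) (V y) := by
    filter_upwards [hf.continuousAt.eventually (eventually_mem_source (n := n) (f x))] with y hy
    exact coord_eq hy _
  exact this.mdifferentiableAt_iff

lemma covAlong_eq {D : LinearConnection n N} {f : M → N} {V : FieldAlong n f} {x : M}
    (hf : ContinuousAt f x) (w : TangentSpace (𝓡 m) x) :
    covAlong D f V x w =
      coordSymm (f x) (f x) (mvfderiv (𝓡 m) (fun y ↦ coord (f x) (f y) (V y)) x w) +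
      D (FiberBundle.extend (EuclideanSpace ℝ (Fin n)) (V x)) (f x)
        (mfderiv (𝓡 m) (𝓡 n) f x w) := by
  have : (fun y ↦ (trivializationAt (EuclideanSpace ℝ (Fin n))
      (TangentSpace (𝓡 n) : N → Type _) (f x) ⟨f y, V y⟩).2) =ᶠ[𝓝 x]
      fun y ↦ coord (f x) (f y) (V y) := by
    filter_upwards [hf.eventually (eventually_mem_source (n := n) (f x))] with y hy
    exact coord_eq hy _
  rw [covAlong, mvfderiv_congr this, symm_eq_coordSymm (mem_chart_source _ _)]

/-- The connection `D` in the coordinates centred at `q`. -/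
lemma connection_eq (D : LinearConnection n N) {Y : Π q : N, TangentSpace (𝓡 n) q} {q : N}
    (hY : MDifferentiableAt (𝓡 n) (𝓡 n).tangent (fun p ↦ (⟨p, Y p⟩ : TangentBundle (𝓡 n) N)) q)
    (u : TangentSpace (𝓡 n) q) :
    D Y q u = coordSymm q q (mvfderiv (𝓡 n) (fun p ↦ coord q p (Y p)) q u) +
      D (FiberBundle.extend (EuclideanSpace ℝ (Fin n)) (Y q)) q u := by
  -- `D₀` is the flat connection of the chart at `q`. The difference of two connections is
  -- tensorial, so it may be evaluated on the extension of `Y q` with constant coordinates, which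
  -- `D₀` annihilates.
  let D₀ : (Π p : N, TangentSpace (𝓡 n) p) →
      (Π p : N, TangentSpace (𝓡 n) p →L[ℝ] TangentSpace (𝓡 n) p) := fun Z p ↦
    (coordSymm q p).comp (mvfderiv (𝓡 n) (fun p' ↦ coord q p' (Z p')) p)
  have hd {Z : Π p : N, TangentSpace (𝓡 n) p}
      (hZ : MDifferentiableAt (𝓡 n) (𝓡 n).tangent
        (fun p ↦ (⟨p, Z p⟩ : TangentBundle (𝓡 n) N)) q) :
      MDifferentiableAt (𝓡 n) 𝓘(ℝ, EuclideanSpace ℝ (Fin n)) (fun p ↦ coord q p (Z p)) q :=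
    (mdifferentiableAt_along_iff (f := id).1 hZ).2
  have hD₀ : IsCovariantDerivativeOn (EuclideanSpace ℝ (Fin n)) D₀ {q} := by
    refine ⟨fun {σ σ' p} hσ hσ' hp ↦ ?_, fun {σ g p} hσ hg hp ↦ ?_⟩
    · obtain rfl : p = q := hp
      ext1 w
      simp only [D₀, Pi.add_apply, map_add]
      erw [mvfderiv_fun_add (hd hσ) (hd hσ')]
      simp
    · obtain rfl : p = q := hp
      ext1 w
      simp only [D₀, Pi.smul_apply', map_smul]
      erw [mvfderiv_fun_smul hg (hd hσ)]
      simp [coordSymm_coord (mem_chart_source _ _)]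
  have hE := FiberBundle.mdifferentiableAt_extend (𝓡 n) (EuclideanSpace ℝ (Fin n)) (Y q)
  have h1 := (D.isCovariantDerivativeOn (s := {q})).difference_apply hD₀ (mem_singleton q) hY
  have h2 := (D.isCovariantDerivativeOn (s := {q})).difference_apply hD₀ (mem_singleton q) hE
  rw [FiberBundle.extend_apply_self, h1] at h2
  have h3 := congrArg (fun T ↦ T u) h2
  have h4 : D₀ (FiberBundle.extend (EuclideanSpace ℝ (Fin n)) (Y q)) q u = 0 := by
    have : (fun p ↦ coord q p (FiberBundle.extend (EuclideanSpace ℝ (Fin n)) (Y q) p))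
        =ᶠ[𝓝 q] fun _ ↦ coord q q (Y q) := by
      filter_upwards [eventually_mem_source (n := n) q] with p hp
      rw [extend_eq hp, coord_coordSymm hp]
    simp [D₀, mvfderiv_congr this, mvfderiv_const]
  simp only [sub_apply, h4, sub_zero] at h3
  rw [sub_eq_iff_eq_add, add_comm] at h3
  exact h3

end Coordinates

/-! ### Differentiation along a map -/

section AlongRules

variable {m n : ℕ} {M N : Type*}
  [TopologicalSpace M] [ChartedSpace (EuclideanSpace ℝ (Fin m)) M]
  [TopologicalSpace N] [ChartedSpace (EuclideanSpace ℝ (Fin n)) N] [IsManifold (𝓡 n) ∞ N]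

/-- A differentiable `(1,1)`-tensor field in coordinates. -/
lemma exists_endomorphism_coord {g : SemiRiemannianMetric n N} (G : GoldenStructure g) (q₀ : N) :
    ∃ A : N → EuclideanSpace ℝ (Fin n) →L[ℝ] EuclideanSpace ℝ (Fin n),
      MDifferentiableAt (𝓡 n)
        𝓘(ℝ, EuclideanSpace ℝ (Fin n) →L[ℝ] EuclideanSpace ℝ (Fin n)) A q₀ ∧
      ∀ q ∈ (chartAt (EuclideanSpace ℝ (Fin n)) q₀).source, ∀ v,
        coord q₀ q (G.P q v) = A q (coord q₀ q v) := by
  have h := ((contMDiffAt_hom_bundle _).1 (G.smooth q₀)).2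
  refine ⟨_, h.mdifferentiableAt (by simp), fun q hq v ↦ ?_⟩
  show _ = coord q₀ q (G.P q (coordSymm q₀ q (coord q₀ q v)))
  rw [coordSymm_coord hq]

/-- The metric in coordinates. -/
lemma exists_metric_coord (g : SemiRiemannianMetric n N) (q₀ : N) :
    ∃ A : N → EuclideanSpace ℝ (Fin n) →L[ℝ] EuclideanSpace ℝ (Fin n) →L[ℝ] ℝ,
      MDifferentiableAt (𝓡 n)
        𝓘(ℝ, EuclideanSpace ℝ (Fin n) →L[ℝ] EuclideanSpace ℝ (Fin n) →L[ℝ] ℝ) A q₀ ∧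
      ∀ q ∈ (chartAt (EuclideanSpace ℝ (Fin n)) q₀).source, ∀ u v,
        g.val q u v = A q (coord q₀ q u) (coord q₀ q v) := by
  have h := ((contMDiffAt_hom_bundle _).1 (g.smooth q₀)).2
  refine ⟨_, h.mdifferentiableAt (by simp), fun q hq u v ↦ ?_⟩
  rw [inCoordinates_apply_eq₂ (by simpa using hq) (by simpa using hq)
    (mem_univ _), symm_eq_coordSymm hq, symm_eq_coordSymm hq, coordSymm_coord hq,
    coordSymm_coord hq]
  simp

variable {f : M → N} {x : M}

/-- The connection along a map is metric. -/
lemma covAlong_metric {g : SemiRiemannianMetric n N} {D : LinearConnection n N}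
    (hD : IsLeviCivita g D) {U V : FieldAlong n f}
    (hU : MDifferentiableAt (𝓡 m) (𝓡 n).tangent (fun y ↦ (⟨f y, U y⟩ : TangentBundle (𝓡 n) N)) x)
    (hV : MDifferentiableAt (𝓡 m) (𝓡 n).tangent (fun y ↦ (⟨f y, V y⟩ : TangentBundle (𝓡 n) N)) x)
    (w : TangentSpace (𝓡 m) x) :
    mvfderiv (𝓡 m) (fun y ↦ g.val (f y) (U y) (V y)) x w =
      g.val (f x) (covAlong D f U x w) (V x) + g.val (f x) (U x) (covAlong D f V x w) := by
  obtain ⟨hf, hu⟩ := mdifferentiableAt_along_iff.1 hU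
  obtain ⟨-, hv⟩ := mdifferentiableAt_along_iff.1 hV
  obtain ⟨A, hA, hAg⟩ := exists_metric_coord g (f x)
  have hx := mem_chart_source (EuclideanSpace ℝ (Fin n)) (f x)
  have hE (a : TangentSpace (𝓡 n) (f x)) :=
    FiberBundle.mdifferentiableAt_extend (𝓡 n) (EuclideanSpace ℝ (Fin n)) a
  -- Applied to fields with constant coordinates, metric compatibility computes the derivative of
  -- the coefficient matrix of `g`; the product rule on `M` supplies the other terms.
  have h1 := hD.metric _ _ (f x) (mfderiv (𝓡 m) (𝓡 n) f x w) (hE (U x)) (hE (V x))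
  have h2 : (fun q ↦ g.val q (FiberBundle.extend (EuclideanSpace ℝ (Fin n)) (U x) q)
      (FiberBundle.extend (EuclideanSpace ℝ (Fin n)) (V x) q)) =ᶠ[𝓝 (f x)]
      fun q ↦ A q (coord (f x) (f x) (U x)) (coord (f x) (f x) (V x)) := by
    filter_upwards [eventually_mem_source (n := n) (f x)] with q hq
    rw [hAg q hq, extend_eq hq, extend_eq hq, coord_coordSymm hq, coord_coordSymm hq]
  have h3 : (fun y ↦ g.val (f y) (U y) (V y)) =ᶠ[𝓝 x]
      fun y ↦ A (f y) (coord (f x) (f y) (U y)) (coord (f x) (f y) (V y)) := by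
    filter_upwards [hf.continuousAt.eventually (eventually_mem_source (n := n) (f x))] with y hy
    exact hAg _ hy _ _
  have hAf : MDifferentiableAt (𝓡 m) _ (fun y ↦ A (f y)) x := hA.comp x hf
  rw [mvfderiv_congr h2, mvfderiv_clm_apply (hA.clm_apply mdifferentiableAt_const)
    mdifferentiableAt_const, mvfderiv_clm_apply hA mdifferentiableAt_const, mvfderiv_const,
    mvfderiv_const] at h1
  simp only [FiberBundle.extend_apply_self, _root_.zero_apply, map_zero,
    add_zero] at h1
  rw [mvfderiv_congr h3, mvfderiv_clm_apply (hAf.clm_apply hu) hv, mvfderiv_clm_apply hAf hu,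
    mvfderiv_comp_manifold hA hf, covAlong_eq hf.continuousAt, covAlong_eq hf.continuousAt]
  simp only [map_add, _root_.add_apply]
  rw [h1, hAg _ hx (coordSymm _ _ _), hAg _ hx _ (coordSymm _ _ _), coord_coordSymm hx,
    coord_coordSymm hx]
  ring

/-- A parallel tensor field commutes with the connection along a map. -/
lemma covAlong_app {g : SemiRiemannianMetric n N} {G : GoldenStructure g} {D : LinearConnection n N}
    (hG : G.IsParallel D) {V : FieldAlong n f}
    (hV : MDifferentiableAt (𝓡 m) (𝓡 n).tangent (fun y ↦ (⟨f y, V y⟩ : TangentBundle (𝓡 n) N)) x)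
    (w : TangentSpace (𝓡 m) x) :
    covAlong D f (G.app V) x w = G.P (f x) (covAlong D f V x w) := by
  obtain ⟨hf, hv⟩ := mdifferentiableAt_along_iff.1 hV
  obtain ⟨A, hA, hAP⟩ := exists_endomorphism_coord G (f x)
  have hx := mem_chart_source (EuclideanSpace ℝ (Fin n)) (f x)
  have hE := FiberBundle.mdifferentiableAt_extend (𝓡 n) (EuclideanSpace ℝ (Fin n)) (V x)
  have hPE : MDifferentiableAt (𝓡 n) (𝓡 n).tangent (fun p ↦ (⟨p, G.P p
      (FiberBundle.extend (EuclideanSpace ℝ (Fin n)) (V x) p)⟩ : TangentBundle (𝓡 n) N)) (f x) :=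
    ((G.smooth (f x)).mdifferentiableAt (by simp)).clm_bundle_apply hE
  -- Parallelism on the constant-coordinate extension expresses the derivative of the matrix of `P`
  -- through `D`. The image field `P E` need not have constant coordinates, hence `connection_eq`.
  have h1 := hG _ (f x) (mfderiv (𝓡 m) (𝓡 n) f x w) hE
  rw [connection_eq D hPE, FiberBundle.extend_apply_self] at h1
  have h2 : (fun q ↦ coord (f x) q (G.P q
      (FiberBundle.extend (EuclideanSpace ℝ (Fin n)) (V x) q))) =ᶠ[𝓝 (f x)]
      fun q ↦ A q (coord (f x) (f x) (V x)) := by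
    filter_upwards [eventually_mem_source (n := n) (f x)] with q hq
    rw [hAP q hq, extend_eq hq, coord_coordSymm hq]
  have h3 : (fun y ↦ coord (f x) (f y) (G.app V y)) =ᶠ[𝓝 x]
      fun y ↦ A (f y) (coord (f x) (f y) (V y)) := by
    filter_upwards [hf.continuousAt.eventually (eventually_mem_source (n := n) (f x))] with y hy
    exact hAP _ hy _
  have hAf : MDifferentiableAt (𝓡 m) _ (fun y ↦ A (f y)) x := hA.comp x hf
  rw [mvfderiv_congr h2, mvfderiv_clm_apply hA mdifferentiableAt_const, mvfderiv_const] at h1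
  rw [covAlong_eq hf.continuousAt, covAlong_eq hf.continuousAt, mvfderiv_congr h3,
    mvfderiv_clm_apply hAf hv, mvfderiv_comp_manifold hA hf, map_add (G.P (f x)), ← h1]
  have h4 (a : EuclideanSpace ℝ (Fin n)) :
      G.P (f x) (coordSymm (f x) (f x) a) = coordSymm (f x) (f x) (A (f x) a) := by
    rw [← coordSymm_coord hx (G.P (f x) _), hAP _ hx, coord_coordSymm hx]
  rw [h4]
  simp only [_root_.zero_apply, map_zero, add_zero, map_add]
  show _ + D (FiberBundle.extend _ (G.P (f x) (V x))) (f x) _ = _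
  abel

end AlongRules

/-! ### The Lie bracket and the torsion along a map -/

section Torsion

variable {m : ℕ} {M : Type*} [TopologicalSpace M] [ChartedSpace (EuclideanSpace ℝ (Fin m)) M]
  [IsManifold (𝓡 m) ∞ M] {F : Type*} [NormedAddCommGroup F] [NormedSpace ℝ F]

/-- `dh [X, Y] = X (dh Y) - Y (dh X)`. -/
lemma mvfderiv_mlieBracket {h : M → F} {x : M} (hh : ContMDiffAt (𝓡 m) 𝓘(ℝ, F) ∞ h x)
    {X Y : Field m M}
    (hX : MDifferentiableAt (𝓡 m) (𝓡 m).tangent (fun y ↦ (⟨y, X y⟩ : TangentBundle (𝓡 m) M)) x)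
    (hY : MDifferentiableAt (𝓡 m) (𝓡 m).tangent (fun y ↦ (⟨y, Y y⟩ : TangentBundle (𝓡 m) M)) x) :
    mvfderiv (𝓡 m) h x (VectorField.mlieBracket (𝓡 m) X Y x) =
      mvfderiv (𝓡 m) (fun y ↦ mvfderiv (𝓡 m) h y (Y y)) x (X x) -
      mvfderiv (𝓡 m) (fun y ↦ mvfderiv (𝓡 m) h y (X y)) x (Y x) := by
  let E := EuclideanSpace ℝ (Fin m)
  set φ := extChartAt (𝓡 m) x with hφ
  let hat (Z : Field m M) : E → E := VectorField.mpullbackWithin 𝓘(ℝ, E) (𝓡 m) φ.symm Z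
    (range (𝓡 m))
  let k : E → F := h ∘ φ.symm
  have hr : range (𝓡 m) = univ := by simp
  have hdiff {Z : Field m M} (hZ : MDifferentiableAt (𝓡 m) (𝓡 m).tangent
      (fun y ↦ (⟨y, Z y⟩ : TangentBundle (𝓡 m) M)) x) : DifferentiableAt ℝ (hat Z) (φ x) := by
    have : DifferentiableWithinAt ℝ (hat Z) (φ.symm ⁻¹' univ ∩ range (𝓡 m)) (φ x) :=
      MDifferentiableWithinAt.differentiableWithinAt_mpullbackWithin_vectorField
        hZ.mdifferentiableWithinAt
    rwa [preimage_univ, univ_inter, hr, differentiableWithinAt_univ] at this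
  have hk : ContDiffAt ℝ ∞ k (φ x) := by
    have := (contMDiffAt_iff.1 hh).2
    rw [hr, contDiffWithinAt_univ] at this
    exact this
  have hdk : mvfderiv (𝓡 m) h x = fderiv ℝ k (φ x) := by
    rw [(hh.mdifferentiableAt (by simp)).mvfderiv, hr, fderivWithin_univ]
    rfl
  -- Chain rule: the derivative of the chart inverse cancels the inverse used to pull `Z` back.
  have hev (Z : Field m M) : (fun y ↦ mvfderiv (𝓡 m) h y (Z y)) ∘ φ.symm =ᶠ[𝓝 (φ x)]
      fun e ↦ fderiv ℝ k e (hat Z e) := by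
    have h1 : ∀ᶠ y in 𝓝 x, MDifferentiableAt (𝓡 m) 𝓘(ℝ, F) h y :=
      ((contMDiffAt_iff_contMDiffAt_nhds (by simp)).1 (hh.of_le (m := 1) (by simp))).mono
        fun y hy ↦ hy.mdifferentiableAt (by simp)
    have h2 : ∀ᶠ e in 𝓝 (φ x), MDifferentiableAt (𝓡 m) 𝓘(ℝ, F) h (φ.symm e) := by
      have : ContinuousAt φ.symm (φ x) := continuousAt_extChartAt_symm x
      rw [← extChartAt_to_inv (I := 𝓡 m) x] at h1
      exact this.eventually h1
    filter_upwards [h2, extChartAt_target_mem_nhds (I := 𝓡 m) x] with e he het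
    have hs := mdifferentiableWithinAt_extChartAt_symm het
    have hinv := isInvertible_mfderivWithin_extChartAt_symm het
    have hc := mfderiv_comp_mfderivWithin e he hs (by rw [hr]; exact uniqueMDiffWithinAt_univ _)
    have hc' : fderiv ℝ k e = (mfderiv (𝓡 m) 𝓘(ℝ, F) h (φ.symm e)).comp
        (mfderivWithin 𝓘(ℝ, E) (𝓡 m) φ.symm (range (𝓡 m)) e) := by
      rw [← hc, hr, mfderivWithin_univ, mfderiv_eq_fderiv]
    rw [hc']
    obtain ⟨T, hT⟩ := hinv
    show _ = mfderiv (𝓡 m) 𝓘(ℝ, F) h (φ.symm e)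
      ((mfderivWithin 𝓘(ℝ, E) (𝓡 m) φ.symm (range (𝓡 m)) e)
        ((mfderivWithin 𝓘(ℝ, E) (𝓡 m) φ.symm (range (𝓡 m)) e).inverse (Z (φ.symm e))))
    rw [← hT, ContinuousLinearMap.inverse_equiv]
    exact congrArg (mfderiv (𝓡 m) 𝓘(ℝ, F) h (φ.symm e)) (T.apply_symm_apply _).symm
  have hhat (Z : Field m M) : hat Z (φ x) = Z x := by
    have h1 := mfderivWithin_extChartAt_symm_inverse_apply (I := 𝓡 m) (x := x) (Z x)
    have h2 : φ.symm (φ x) = x := extChartAt_to_inv x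
    let Z' : M → E := Z
    have h3 : Z' (φ.symm (φ x)) = Z' x := congrArg Z' h2
    refine Eq.trans ?_ h1
    exact congrArg (mfderivWithin 𝓘(ℝ, E) (𝓡 m) φ.symm (range (𝓡 m)) (φ x)).inverse h3
  have hder {Z : Field m M} (hZ : MDifferentiableAt (𝓡 m) (𝓡 m).tangent
      (fun y ↦ (⟨y, Z y⟩ : TangentBundle (𝓡 m) M)) x) (w : E) :
      mvfderiv (𝓡 m) (fun y ↦ mvfderiv (𝓡 m) h y (Z y)) x w =
        fderiv ℝ (fderiv ℝ k) (φ x) w (hat Z (φ x)) +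
          fderiv ℝ k (φ x) (fderiv ℝ (hat Z) (φ x) w) := by
    have hk' : DifferentiableAt ℝ (fderiv ℝ k) (φ x) :=
      (hk.fderiv_right (m := 1) (WithTop.coe_le_coe.2 le_top)).differentiableAt (by simp)
    have hd := (hk'.clm_apply (hdiff hZ)).congr_of_eventuallyEq (hev Z)
    have hu : MDifferentiableAt (𝓡 m) 𝓘(ℝ, F) (fun y ↦ mvfderiv (𝓡 m) h y (Z y)) x := by
      rw [← mdifferentiableWithinAt_univ]
      refine DifferentiableWithinAt.mdifferentiableWithinAt_of_comp_extChartAt_symm ?_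
      exact hd.differentiableWithinAt
    have h1 : mvfderiv (𝓡 m) (fun y ↦ mvfderiv (𝓡 m) h y (Z y)) x =
        fderiv ℝ ((fun y ↦ mvfderiv (𝓡 m) h y (Z y)) ∘ φ.symm) (φ x) := by
      rw [hu.mvfderiv, hr, fderivWithin_univ]
      rfl
    rw [h1, (hev Z).fderiv_eq, fderiv_clm_apply hk' (hdiff hZ)]
    exact add_comm _ _
  have hbr : mvfderiv (𝓡 m) h x (VectorField.mlieBracket (𝓡 m) X Y x) =
      fderiv ℝ k (φ x) (VectorField.lieBracket ℝ (hat X) (hat Y) (φ x)) := by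
    have hid (v : E) : (mfderiv (𝓡 m) 𝓘(ℝ, E) φ x).inverse v = v := by
      rw [mfderiv_extChartAt_self]
      show (ContinuousLinearMap.id ℝ E).inverse v = v
      rw [ContinuousLinearMap.inverse_id]
      rfl
    have h1 : VectorField.mlieBracket (𝓡 m) X Y x = VectorField.lieBracketWithin ℝ (hat X) (hat Y)
        (φ.symm ⁻¹' univ ∩ range (𝓡 m)) (φ x) := by
      rw [← VectorField.mlieBracketWithin_univ, VectorField.mlieBracketWithin_apply]
      exact hid _
    rw [preimage_univ, univ_inter, hr, VectorField.lieBracketWithin_univ] at h1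
    rw [hdk]
    exact congrArg _ h1
  -- Symmetry of the second derivative cancels the Hessian terms in the commutator, leaving `dk` of
  -- the coordinate bracket.
  have hsymm : IsSymmSndFDerivAt ℝ k (φ x) :=
    hk.isSymmSndFDerivAt (by simpa using (WithTop.coe_le_coe.2 le_top : ((2 : ℕ∞) : WithTop ℕ∞) ≤ ∞))
  have h3 : fderiv ℝ (fderiv ℝ k) (φ x) (hat Y (φ x)) (hat X (φ x)) =
    fderiv ℝ (fderiv ℝ k) (φ x) (hat X (φ x)) (hat Y (φ x)) := hsymm _ _
  rw [hbr, ← hhat X, ← hhat Y, hder hX, hder hY, h3]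
  rw [VectorField.lieBracket, map_sub]
  abel

end Torsion

section AlongTorsion

variable {m n : ℕ} {M N : Type*}
  [TopologicalSpace M] [ChartedSpace (EuclideanSpace ℝ (Fin m)) M] [IsManifold (𝓡 m) ∞ M]
  [TopologicalSpace N] [ChartedSpace (EuclideanSpace ℝ (Fin n)) N] [IsManifold (𝓡 n) ∞ N]

/-- The chart differential of each extension is locally constant, so the bracket formula applied to
the chart gives zero; that differential is injective at `q`. -/
lemma mlieBracket_extend {q : N} (a b : TangentSpace (𝓡 n) q) :
    VectorField.mlieBracket (𝓡 n) (FiberBundle.extend (EuclideanSpace ℝ (Fin n)) a)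
      (FiberBundle.extend (EuclideanSpace ℝ (Fin n)) b) q = 0 := by
  have hq := mem_chart_source (EuclideanSpace ℝ (Fin n)) q
  have hE (a : TangentSpace (𝓡 n) q) :=
    FiberBundle.mdifferentiableAt_extend (𝓡 n) (EuclideanSpace ℝ (Fin n)) a
  have h0 (a : TangentSpace (𝓡 n) q) : mvfderiv (𝓡 n) (fun p ↦ mvfderiv (𝓡 n)
      (extChartAt (𝓡 n) q) p (FiberBundle.extend (EuclideanSpace ℝ (Fin n)) a p)) q = 0 := by
    have : (fun p ↦ mvfderiv (𝓡 n) (extChartAt (𝓡 n) q) p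
        (FiberBundle.extend (EuclideanSpace ℝ (Fin n)) a p)) =ᶠ[𝓝 q] fun _ ↦ coord q q a := by
      filter_upwards [eventually_mem_source (n := n) q] with p hp
      rw [← coord_eq_mvfderiv hp, extend_eq hp, coord_coordSymm hp]
    rw [mvfderiv_congr this, mvfderiv_const]
  have h1 := mvfderiv_mlieBracket (h := extChartAt (𝓡 n) q) (contMDiffAt_extChartAt (n := ∞))
    (hE a) (hE b)
  rw [h0, h0, ← coord_eq_mvfderiv hq] at h1
  rw [← coordSymm_coord hq (VectorField.mlieBracket _ _ _ _), h1]
  simp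

/-- The connection along a map is torsion-free. -/
lemma covAlong_torsion {g : SemiRiemannianMetric n N} {D : LinearConnection n N}
    (hD : IsLeviCivita g D) {f : M → N} {x : M} (hf : ContMDiffAt (𝓡 m) (𝓡 n) ∞ f x)
    {W U : Field m M}
    (hW : MDifferentiableAt (𝓡 m) (𝓡 m).tangent (fun y ↦ (⟨y, W y⟩ : TangentBundle (𝓡 m) M)) x)
    (hU : MDifferentiableAt (𝓡 m) (𝓡 m).tangent (fun y ↦ (⟨y, U y⟩ : TangentBundle (𝓡 m) M)) x) :
    covAlong D f (push f U) x (W x) - covAlong D f (push f W) x (U x) =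
      push f (VectorField.mlieBracket (𝓡 m) W U) x := by
  have hx := mem_chart_source (EuclideanSpace ℝ (Fin n)) (f x)
  have hE (a : TangentSpace (𝓡 n) (f x)) :=
    FiberBundle.mdifferentiableAt_extend (𝓡 n) (EuclideanSpace ℝ (Fin n)) a
  have hd : ∀ᶠ y in 𝓝 x, MDifferentiableAt (𝓡 m) (𝓡 n) f y :=
    ((contMDiffAt_iff_contMDiffAt_nhds (by simp)).1 (hf.of_le (m := 1) (by simp))).mono
      fun y hy ↦ hy.mdifferentiableAt (by simp)
  have hchain : ∀ᶠ y in 𝓝 x, ∀ v : TangentSpace (𝓡 m) y,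
      coord (f x) (f y) (mfderiv (𝓡 m) (𝓡 n) f y v) =
        mvfderiv (𝓡 m) (fun z ↦ extChartAt (𝓡 n) (f x) (f z)) y v := by
    filter_upwards [hd, hf.continuousAt.eventually (eventually_mem_source (n := n) (f x))]
      with y hy hys v
    rw [mvfderiv_comp_manifold (mdifferentiableAt_extChartAt hys) hy, coord_eq_mvfderiv hys]
  have hpush (Z : Field m M) : (fun y ↦ coord (f x) (f y) (push f Z y)) =ᶠ[𝓝 x]
      fun y ↦ mvfderiv (𝓡 m) (fun z ↦ extChartAt (𝓡 n) (f x) (f z)) y (Z y) :=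
    hchain.mono fun y hy ↦ hy (Z y)
  have hh : ContMDiffAt (𝓡 m) 𝓘(ℝ, EuclideanSpace ℝ (Fin n)) ∞
      (fun z ↦ extChartAt (𝓡 n) (f x) (f z)) x :=
    (contMDiffAt_extChartAt (n := ∞)).comp x hf
  -- The bracket formula for the chart composed with `f` handles the derivative terms; the
  -- connection terms are then handled by the torsion of commuting extensions.
  have h1 := mvfderiv_mlieBracket hh hW hU
  rw [← hchain.self_of_nhds, ← mvfderiv_congr (hpush U), ← mvfderiv_congr (hpush W)] at h1
  have h2 := hD.torsion_free _ _ (f x) (hE (push f W x)) (hE (push f U x))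
  rw [mlieBracket_extend, FiberBundle.extend_apply_self, FiberBundle.extend_apply_self] at h2
  rw [covAlong_eq hf.continuousAt, covAlong_eq hf.continuousAt, add_sub_add_comm, ← map_sub, ← h1,
    coordSymm_coord hx]
  exact (congrArg _ h2).trans (add_zero _)

end AlongTorsion

/-! ### Sections of a distribution with a prescribed value -/

section Sections

variable {m n : ℕ} {M N : Type*}
  [TopologicalSpace M] [ChartedSpace (EuclideanSpace ℝ (Fin m)) M] [IsManifold (𝓡 m) ∞ M]
  [TopologicalSpace N] [ChartedSpace (EuclideanSpace ℝ (Fin n)) N] [IsManifold (𝓡 n) ∞ N]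

omit [IsManifold (𝓡 m) ∞ M] in
/-- Smoothness of a section along `f`, in coordinates. -/
lemma contMDiffAt_along_iff {f : M → N} {V : FieldAlong n f} {x : M} :
    ContMDiffAt (𝓡 m) (𝓡 n).tangent ∞ (fun y ↦ (⟨f y, V y⟩ : TangentBundle (𝓡 n) N)) x ↔
      ContMDiffAt (𝓡 m) (𝓡 n) ∞ f x ∧
      ContMDiffAt (𝓡 m) 𝓘(ℝ, EuclideanSpace ℝ (Fin n)) ∞
        (fun y ↦ coord (f x) (f y) (V y)) x := by
  rw [contMDiffAt_totalSpace]
  refine and_congr_right fun hf ↦ ?_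
  have : (fun y ↦ (trivializationAt (EuclideanSpace ℝ (Fin n))
      (TangentSpace (𝓡 n) : N → Type _) (f x) ⟨f y, V y⟩).2) =ᶠ[𝓝 x]
      fun y ↦ coord (f x) (f y) (V y) := by
    filter_upwards [hf.continuousAt.eventually (eventually_mem_source (n := n) (f x))] with y hy
    exact coord_eq hy _
  exact this.contMDiffAt_iff

/-- A vector field is smooth when its image under an immersion is. -/
lemma contMDiffAt_of_push {f : M → N} {W : Field m M} {V : FieldAlong n f} {x : M}
    (hf : ContMDiffAt (𝓡 m) (𝓡 n) ∞ f x)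
    (hinj : Function.Injective (mfderiv (𝓡 m) (𝓡 n) f x))
    (hV : ContMDiffAt (𝓡 m) (𝓡 n).tangent ∞ (fun y ↦ (⟨f y, V y⟩ : TangentBundle (𝓡 n) N)) x)
    (hWV : ∀ᶠ y in 𝓝 x, push f W y = V y) :
    ContMDiffAt (𝓡 m) (𝓡 m).tangent ∞ (fun y ↦ (⟨y, W y⟩ : TangentBundle (𝓡 m) M)) x := by
  refine (contMDiffAt_along_iff (f := id)).2 ⟨contMDiffAt_id, ?_⟩
  have hxM := mem_chart_source (EuclideanSpace ℝ (Fin m)) x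
  have hxN := mem_chart_source (EuclideanSpace ℝ (Fin n)) (f x)
  have hv := (contMDiffAt_along_iff.1 hV).2
  let A : M → EuclideanSpace ℝ (Fin m) →L[ℝ] EuclideanSpace ℝ (Fin n) := fun y ↦
    (coord (f x) (f y)).comp ((mfderiv (𝓡 m) (𝓡 n) f y).comp (coordSymm x y))
  have hA : ContMDiffAt (𝓡 m)
      𝓘(ℝ, EuclideanSpace ℝ (Fin m) →L[ℝ] EuclideanSpace ℝ (Fin n)) ∞ A x :=
    hf.mfderiv_const (m := ∞) (by simp)
  have hAinj : Function.Injective (A x) := by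
    have h1 : Function.Injective (coord (f x) (f x)) :=
      Function.LeftInverse.injective (coordSymm_coord hxN)
    have h2 : Function.Injective (coordSymm x x) :=
      Function.LeftInverse.injective (coord_coordSymm hxM)
    exact h1.comp (hinj.comp h2)
  -- A fixed left inverse `L` of the matrix of `df` at `x` makes `B = L A` the identity at `x`,
  -- hence invertible nearby; the coordinates of `W` are then `B⁻¹ L` applied to those of `V`.
  obtain ⟨L₀, hL₀⟩ := (A x).toLinearMap.exists_leftInverse_of_injective
    (LinearMap.ker_eq_bot.2 hAinj)
  let L : EuclideanSpace ℝ (Fin n) →L[ℝ] EuclideanSpace ℝ (Fin m) := L₀.toContinuousLinearMap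
  let B : M → EuclideanSpace ℝ (Fin m) →L[ℝ] EuclideanSpace ℝ (Fin m) := fun y ↦ L.comp (A y)
  have hB : ContMDiffAt (𝓡 m)
      𝓘(ℝ, EuclideanSpace ℝ (Fin m) →L[ℝ] EuclideanSpace ℝ (Fin m)) ∞ B x :=
    contMDiffAt_const.clm_comp hA
  have hBx : B x = ((1 : (EuclideanSpace ℝ (Fin m) →L[ℝ] EuclideanSpace ℝ (Fin m))ˣ) :
      EuclideanSpace ℝ (Fin m) →L[ℝ] EuclideanSpace ℝ (Fin m)) := by
    ext1 v
    exact congrArg (fun T ↦ T v) hL₀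
  have hBunit : ∀ᶠ y in 𝓝 x, IsUnit (B y) := by
    refine hB.continuousAt.eventually (Units.isOpen.mem_nhds ?_)
    exact ⟨1, hBx.symm⟩
  have hBinv : ContMDiffAt (𝓡 m)
      𝓘(ℝ, EuclideanSpace ℝ (Fin m) →L[ℝ] EuclideanSpace ℝ (Fin m)) ∞
      (fun y ↦ Ring.inverse (B y)) x := by
    have h1 := contDiffAt_ringInverse ℝ (n := ∞)
      (1 : (EuclideanSpace ℝ (Fin m) →L[ℝ] EuclideanSpace ℝ (Fin m))ˣ)
    rw [← hBx] at h1
    exact h1.contMDiffAt.comp x hB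
  refine (hBinv.clm_apply ((contMDiffAt_const (c := L)).clm_apply hv)).congr_of_eventuallyEq ?_
  filter_upwards [hBunit, hWV, eventually_mem_source (n := m) x] with y hy hyV hys
  have h1 : L (coord (f x) (f y) (V y)) = B y (coord x y (W y)) := by
    show _ = L (coord (f x) (f y) (mfderiv (𝓡 m) (𝓡 n) f y (coordSymm x y (coord x y (W y)))))
    rw [coordSymm_coord hys, ← hyV]
    rfl
  rw [h1]
  exact (congrArg (fun T ↦ T (coord x y (W y))) (Ring.inverse_mul_cancel _ hy)).symm

/-- Every vector of a smooth subbundle of the tangent bundle of an immersed manifold extends to a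
smooth section. -/
lemma exists_section [T2Space M] {f : M → N} (hf : ContMDiff (𝓡 m) (𝓡 n) ∞ f)
    (hinj : ∀ x, Function.Injective (mfderiv (𝓡 m) (𝓡 n) f x)) {A : SubspaceFieldAlong n f}
    (hA : IsSmoothSubbundle m f A) (hAT : ∀ x, A x ≤ tangent m f x) {x₀ : M}
    {v : TangentSpace (𝓡 n) (f x₀)} (hv : v ∈ A x₀) :
    ∃ W : Field m M, (IsSmoothField W ∧ ∀ x, push f W x ∈ A x) ∧ push f W x₀ = v := by
  obtain ⟨u, hu, hxu, k, s, hs, hspan⟩ := hA x₀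
  rw [← (hspan x₀ hxu).2, Submodule.mem_span_range_iff_exists_fun] at hv
  obtain ⟨c, hc⟩ := hv
  -- Near `x₀`, keep the frame coefficients of `v` constant; the result is then lifted through `df`
  -- and cut off by a bump function.
  let V : FieldAlong n f := fun x ↦ ∑ i, c i • s i x
  have hVA : ∀ x ∈ u, V x ∈ A x := fun x hx ↦ by
    rw [← (hspan x hx).2]
    exact Submodule.sum_mem _ fun i _ ↦
      Submodule.smul_mem _ _ (Submodule.subset_span (mem_range_self i))
  have hVs : ∀ x ∈ u, ContMDiffAt (𝓡 m) (𝓡 n).tangent ∞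
      (fun y ↦ (⟨f y, V y⟩ : TangentBundle (𝓡 n) N)) x := fun x hx ↦ by
    refine contMDiffAt_along_iff.2 ⟨hf x, ?_⟩
    have h1 (i : Fin k) := (contMDiffAt_along_iff.1
      ((hs i).contMDiffAt (hu.mem_nhds hx))).2
    simp only [V, map_sum, map_smul]
    refine ContMDiffAt.sum fun i _ ↦ ?_
    exact ContMDiffAt.smul (contMDiffAt_const (I' := 𝓘(ℝ, ℝ)) (c := c i)) (h1 i)
  choose! W₀ hW₀ using fun x (hx : x ∈ u) ↦
    (hAT x (hVA x hx) : ∃ w, mfderiv (𝓡 m) (𝓡 n) f x w = V x)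
  replace hW₀ : ∀ x ∈ u, mfderiv (𝓡 m) (𝓡 n) f x (W₀ x) = V x := hW₀
  obtain ⟨ψ, -, hψ⟩ :=
    (SmoothBumpFunction.nhds_basis_tsupport (I := 𝓡 m) x₀).mem_iff.1 (hu.mem_nhds hxu)
  have hW₀s : ContMDiffOn (𝓡 m) (𝓡 m).tangent ∞
      (fun x ↦ (⟨x, W₀ x⟩ : TangentBundle (𝓡 m) M)) u := fun x hx ↦
    (contMDiffAt_of_push (hf x) (hinj x) (hVs x hx)
      (Filter.eventually_of_mem (hu.mem_nhds hx) hW₀)).contMDiffWithinAt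
  have hpush : ∀ x, push f ((ψ : M → ℝ) • W₀) x = ψ x • mfderiv (𝓡 m) (𝓡 n) f x (W₀ x) :=
    fun x ↦ map_smul (mfderiv (𝓡 m) (𝓡 n) f x) (ψ x) (W₀ x)
  refine ⟨(ψ : M → ℝ) • W₀, ⟨ContMDiffOn.smul_section_of_tsupport ψ.contMDiff.contMDiffOn hu hψ hW₀s,
    fun x ↦ ?_⟩, ?_⟩
  · rw [hpush]
    by_cases hx : x ∈ u
    · rw [hW₀ x hx]
      exact Submodule.smul_mem _ _ (hVA x hx)
    · rw [image_eq_zero_of_notMem_tsupport fun h ↦ hx (hψ h), zero_smul]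
      exact Submodule.zero_mem _
  · rw [hpush, ψ.eq_one, one_smul, hW₀ x₀ hxu]
    exact hc

end Sections

/-! ### Transversal lightlike submanifolds -/

section Main

variable {m n r : ℕ} {M N : Type*}
  [TopologicalSpace M] [ChartedSpace (EuclideanSpace ℝ (Fin m)) M] [IsManifold (𝓡 m) ∞ M]
  [TopologicalSpace N] [ChartedSpace (EuclideanSpace ℝ (Fin n)) N] [IsManifold (𝓡 n) ∞ N]

/-- The metric at a point, as a bilinear form. -/
noncomputable def SemiRiemannianMetric.bilin (g : SemiRiemannianMetric n N) (q : N) :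
    LinearMap.BilinForm ℝ (TangentSpace (𝓡 n) q) :=
  LinearMap.mk₂ ℝ (fun u v ↦ g.val q u v) (by simp) (by simp) (by simp) (by simp)

lemma MDifferentiableAt.push {f : M → N} {W : Field m M} {x : M}
    (hf : ContMDiffAt (𝓡 m) (𝓡 n) ∞ f x)
    (hW : MDifferentiableAt (𝓡 m) (𝓡 m).tangent (fun y ↦ (⟨y, W y⟩ : TangentBundle (𝓡 m) M)) x) :
    MDifferentiableAt (𝓡 m) (𝓡 n).tangent
      (fun y ↦ (⟨f y, push f W y⟩ : TangentBundle (𝓡 n) N)) x := by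
  refine mdifferentiableAt_along_iff.2 ⟨hf.mdifferentiableAt (by simp), ?_⟩
  let A : M → EuclideanSpace ℝ (Fin m) →L[ℝ] EuclideanSpace ℝ (Fin n) := fun y ↦
    (coord (f x) (f y)).comp ((mfderiv (𝓡 m) (𝓡 n) f y).comp (coordSymm x y))
  have hA : ContMDiffAt (𝓡 m)
      𝓘(ℝ, EuclideanSpace ℝ (Fin m) →L[ℝ] EuclideanSpace ℝ (Fin n)) ∞ A x :=
    hf.mfderiv_const (m := ∞) (by simp)
  have hw := (mdifferentiableAt_along_iff (f := id).1 hW).2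
  refine ((hA.mdifferentiableAt (by simp)).clm_apply hw).congr_of_eventuallyEq ?_
  filter_upwards [eventually_mem_source (n := m) x] with y hy
  show _ = coord (f x) (f y) (mfderiv (𝓡 m) (𝓡 n) f y (coordSymm x y (coord x y (W y))))
  rw [coordSymm_coord hy]
  rfl

namespace LightlikeSubmanifold

variable {g : SemiRiemannianMetric n N} (L : LightlikeSubmanifold m M g r)

lemma isLightlikeDecomposition (x : M) :
    IsLightlikeDecomposition (g.bilin (L.f x)) (L.screen x) (rad m g L.f x) (L.ltr x) (L.str x) where
  symm := g.symm (L.f x)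
  nondegenerate := g.nondegenerate (L.f x)
  rad := by rw [L.screen_sup]; rfl
  S_inf := L.screen_inf x
  T_inf := L.str_inf x
  T_sup := by rw [L.screen_sup]; exact L.str_sup x
  K_inf := L.ltr_inf x
  K_sup := L.ltr_sup x

instance (q : N) : FiniteDimensional ℝ (TangentSpace (𝓡 n) q) :=
  inferInstanceAs (FiniteDimensional ℝ (EuclideanSpace ℝ (Fin n)))

variable {L}

lemma IsSectionOf.mdifferentiableAt {A : SubspaceFieldAlong n L.f} {W : Field m M}
    (hW : L.IsSectionOf A W) (x : M) :
    MDifferentiableAt (𝓡 m) (𝓡 m).tangent (fun y ↦ (⟨y, W y⟩ : TangentBundle (𝓡 m) M)) x :=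
  (hW.1 x).mdifferentiableAt (by simp)

lemma IsSectionOf.mdifferentiableAt_push {A : SubspaceFieldAlong n L.f} {W : Field m M}
    (hW : L.IsSectionOf A W) (x : M) :
    MDifferentiableAt (𝓡 m) (𝓡 n).tangent
      (fun y ↦ (⟨L.f y, push L.f W y⟩ : TangentBundle (𝓡 n) N)) x :=
  MDifferentiableAt.push (L.smooth x) (hW.mdifferentiableAt x)

lemma exists_isSectionOf [T2Space M] {A : SubspaceFieldAlong n L.f} (hA : IsSmoothSubbundle m L.f A)
    (hAT : ∀ x, A x ≤ tangent m L.f x) {x : M} {v : TangentSpace (𝓡 n) (L.f x)} (hv : v ∈ A x) :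
    ∃ W : Field m M, L.IsSectionOf A W ∧ push L.f W x = v :=
  exists_section L.smooth L.immersion hA hAT hv

lemma screen_le_tangent (x : M) : L.screen x ≤ tangent m L.f x :=
  le_sup_left.trans (L.screen_sup x).le

lemma rad_le_tangent (x : M) : rad m g L.f x ≤ tangent m L.f x := inf_le_left

/-- For orthogonal sections `U` and `Z` along the submanifold,
`g (D_w U, Z) = - g (U, D_w Z)`. -/
lemma val_covAlong_eq_neg {D : LinearConnection n N} (hD : IsLeviCivita g D) {U Z : Field m M}
    (hU : L.IsSectionOf (rad m g L.f) U) (hZ : L.IsSectionOf L.screen Z) (x : M)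
    (w : TangentSpace (𝓡 m) x) :
    g.val (L.f x) (push L.f Z x) (covAlong D L.f (push L.f U) x w) =
      - g.val (L.f x) (push L.f U x) (covAlong D L.f (push L.f Z) x w) := by
  have h1 := covAlong_metric hD (hU.mdifferentiableAt_push x) (hZ.mdifferentiableAt_push x) w
  have h2 : (fun y ↦ g.val (L.f y) (push L.f U y) (push L.f Z y)) = fun _ ↦ 0 := by
    funext y
    rw [g.symm]
    exact (L.isLightlikeDecomposition y).S_R (hZ.2 y) (hU.2 y)
  rw [h2, mvfderiv_const, g.symm _ (covAlong _ _ _ _ _)] at h1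
  exact eq_neg_of_add_eq_zero_left h1.symm

variable {G : GoldenStructure g} {D : LinearConnection n N}

lemma hl_eq_zero_iff (W Z : Field m M) (x : M) :
    L.hl D W Z x = 0 ↔ ∀ ρ ∈ rad m g L.f x,
      g.val (L.f x) ρ (covAlong D L.f (push L.f Z) x (W x)) = 0 :=
  (L.isLightlikeDecomposition x).projK_eq_zero_iff _

lemma inducedConnection_mem_rad_iff (W U : Field m M) (x : M) :
    L.inducedConnection D W U x ∈ rad m g L.f x ↔ ∀ s ∈ L.screen x,
      g.val (L.f x) s (covAlong D L.f (push L.f U) x (W x)) = 0 := by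
  rw [inducedConnection, projTangent, ← L.screen_sup]
  exact (L.isLightlikeDecomposition x).projTangent_mem_R_iff _

lemma K₂Phl_eq_zero_iff (hL : L.IsTransversal G) (W Z : Field m M) (x : M) :
    L.K₂Phl G D W Z x = 0 ↔ L.hl D W Z x = 0 :=
  (L.isLightlikeDecomposition x).projR_P_projK_eq_zero_iff
    (P := (G.P (L.f x)).toLinearMap) (G.golden _) (hL.map_rad x) _

/-- `-A_{PZ} W = M₁ hˢ(W, Z) + K₂ P hˡ(W, Z)`, and the second summand is the `Rad TM`-part. -/
lemma neg_shape_app (hG : G.IsParallel D) (hL : L.IsTransversal G) {Z : Field m M}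
    (hZ : L.IsSectionOf L.screen Z) (W : Field m M) (x : M) :
    - L.shape D (G.app (push L.f Z)) W x = L.M₁hs G D W Z x + L.K₂Phl G D W Z x ∧
      L.projRad x (- L.shape D (G.app (push L.f Z)) W x) = L.K₂Phl G D W Z x := by
  have h := (L.isLightlikeDecomposition x).projTangent_P
    (P := (G.P (L.f x)).toLinearMap) (G.golden _) (G.compatible _) (hL.map_rad x)
    (hL.map_screen x) (covAlong D L.f (push L.f Z) x (W x))
  rw [shape, neg_neg, covAlong_app hG (hZ.mdifferentiableAt_push x), projTangent, ← L.screen_sup]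
  exact h

lemma projRad_shape_eq_zero_iff (hG : G.IsParallel D) (hL : L.IsTransversal G) {Z : Field m M}
    (hZ : L.IsSectionOf L.screen Z) (W : Field m M) (x : M) :
    L.projRad x (L.shape D (G.app (push L.f Z)) W x) = 0 ↔ L.K₂Phl G D W Z x = 0 := by
  rw [← (neg_shape_app hG hL hZ W x).2, map_neg, neg_eq_zero]

lemma neg_shape_eq_iff (hG : G.IsParallel D) (hL : L.IsTransversal G) {Z : Field m M}
    (hZ : L.IsSectionOf L.screen Z) (W : Field m M) (x : M) :
    - L.shape D (G.app (push L.f Z)) W x = L.M₁hs G D W Z x ↔ L.K₂Phl G D W Z x = 0 := by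
  rw [(neg_shape_app hG hL hZ W x).1, add_eq_left]

/-- `Rad TM` is totally geodesic exactly when `hˡ(W, Z) = 0` for `W` in `Rad TM` and `Z` in
`S(TM)`. -/
lemma inducedConnection_mem_rad_iff_hl [T2Space M] (hD : IsLeviCivita g D) :
    (∀ W U : Field m M, L.IsSectionOf (rad m g L.f) W → L.IsSectionOf (rad m g L.f) U →
      ∀ x, L.inducedConnection D W U x ∈ rad m g L.f x) ↔
    ∀ W Z : Field m M, L.IsSectionOf (rad m g L.f) W → L.IsSectionOf L.screen Z →
      ∀ x, L.hl D W Z x = 0 := by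
  constructor
  · intro h W Z hW hZ x
    rw [hl_eq_zero_iff]
    intro ρ hρ
    -- The hypothesis concerns global sections only, so the test vector is realised as the value of
    -- one.
    obtain ⟨U, hU, rfl⟩ := exists_isSectionOf L.rad_smooth rad_le_tangent hρ
    rw [← neg_eq_zero, ← val_covAlong_eq_neg hD hU hZ]
    exact (inducedConnection_mem_rad_iff W U x).1 (h W U hW hU x) _ (hZ.2 x)
  · intro h W U hW hU x
    rw [inducedConnection_mem_rad_iff]
    intro s hs
    obtain ⟨Z, hZ, rfl⟩ := exists_isSectionOf L.screen_smooth screen_le_tangent hs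
    rw [val_covAlong_eq_neg hD hU hZ, neg_eq_zero]
    exact (hl_eq_zero_iff W Z x).1 (h W Z hW hZ x) _ (hU.2 x)

/-- A distribution to which `∇_W U` is tangent whenever `W` and `U` are is involutive. -/
lemma definesTotallyGeodesicFoliation_iff (hD : IsLeviCivita g D) (A : SubspaceFieldAlong n L.f) :
    L.DefinesTotallyGeodesicFoliation D A ↔
      ∀ W U : Field m M, L.IsSectionOf A W → L.IsSectionOf A U →
        ∀ x, L.inducedConnection D W U x ∈ A x := by
  refine ⟨fun h ↦ h.2, fun h ↦ ⟨fun W U hW hU x ↦ ?_, h⟩⟩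
  -- The bracket is tangent to `M`, so it equals the tangential part of `D_W U - D_U W`, that is
  -- `∇_W U - ∇_U W`.
  have h1 := covAlong_torsion hD (L.smooth x) (hW.mdifferentiableAt x) (hU.mdifferentiableAt x)
  have h2 : L.projTangent x (push L.f (VectorField.mlieBracket (𝓡 m) W U) x) =
      push L.f (VectorField.mlieBracket (𝓡 m) W U) x := by
    rw [projTangent, ← L.screen_sup]
    refine (L.isLightlikeDecomposition x).projTangent_of_mem ?_
    rw [L.screen_sup]
    exact ⟨_, rfl⟩
  rw [← h2, ← h1, map_sub]
  exact Submodule.sub_mem _ (h W U hW hU x) (h U W hU hW x)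

end LightlikeSubmanifold

end Main

end GoldenLightlike

theorem mainTheorem10 {m n r : ℕ} {M N : Type*}
    [TopologicalSpace M] [T2Space M] [ChartedSpace (EuclideanSpace ℝ (Fin m)) M]
    [IsManifold (𝓡 m) ∞ M]
    [TopologicalSpace N] [T2Space N] [ChartedSpace (EuclideanSpace ℝ (Fin n)) N]
    [IsManifold (𝓡 n) ∞ N]
    (g : GoldenLightlike.SemiRiemannianMetric n N)
    (D : GoldenLightlike.LinearConnection n N) (hD : GoldenLightlike.IsLeviCivita g D)
    (G : GoldenLightlike.GoldenStructure g) (hG : G.IsParallel D)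
    (L : GoldenLightlike.LightlikeSubmanifold m M g r) (hL : L.IsTransversal G) :
    (L.DefinesTotallyGeodesicFoliation D (GoldenLightlike.rad m g L.f) ↔
      ∀ W Z : GoldenLightlike.Field m M,
        L.IsSectionOf (GoldenLightlike.rad m g L.f) W → L.IsSectionOf L.screen Z →
        ∀ x, L.projRad x (L.shape D (G.app (GoldenLightlike.push L.f Z)) W x) = 0) ∧
    ∀ W Z : GoldenLightlike.Field m M,
      L.IsSectionOf (GoldenLightlike.rad m g L.f) W → L.IsSectionOf L.screen Z →
      ((∀ x, L.projRad x (L.shape D (G.app (GoldenLightlike.push L.f Z)) W x) = 0) ↔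
        ∀ x, L.K₂Phl G D W Z x = 0) ∧
      ((∀ x, L.K₂Phl G D W Z x = 0) ↔
        ∀ x, - L.shape D (G.app (GoldenLightlike.push L.f Z)) W x = L.M₁hs G D W Z x) := by
  refine ⟨?_, fun W Z _ hZ ↦ ⟨forall_congr' fun x ↦
    GoldenLightlike.LightlikeSubmanifold.projRad_shape_eq_zero_iff hG hL hZ W x,
    forall_congr' fun x ↦
      (GoldenLightlike.LightlikeSubmanifold.neg_shape_eq_iff hG hL hZ W x).symm⟩⟩
  rw [GoldenLightlike.LightlikeSubmanifold.definesTotallyGeodesicFoliation_iff hD,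
    GoldenLightlike.LightlikeSubmanifold.inducedConnection_mem_rad_iff_hl hD]
  refine forall₂_congr fun W Z ↦ forall₂_congr fun _ hZ ↦ forall_congr' fun x ↦ ?_
  rw [GoldenLightlike.LightlikeSubmanifold.projRad_shape_eq_zero_iff hG hL hZ,
    GoldenLightlike.LightlikeSubmanifold.K₂Phl_eq_zero_iff hL]
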